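/- For $n\ge 1$ let $\pi$ be a uniformly random permutation of $[n]=\{1,\dots,n\}$, written as the word $\pi_1\pi_2\cdots\pi_n$. A run of $\pi$ is a maximal consecutive increasing subsequence of this word, and $\mathsf{runsort}(\pi)$ is the permutation obtained by sorting the runs of $\pi$ into lexicographic order and concatenating them. For $i,j\in[n]$ let $p'_n(i,j)$ be the probability that the entry $j$ is in the $i$-th position of $\mathsf{runsort}(\pi)$ and is not the beginning of a run of $\pi$. Let $$\mathcal C^+=\{(x,y)\in[0,1]^2 : x<ye^{1-y}\}.$$ Fix $x,y\in(0,1]$ with $(x,y)\in\mathcal C^+$. Then there is a constant $C$, depending only on $(x,y)$, such that for all $n\ge 1$ $$\left|\,p'_n(\lceil xn\rceil,\lceil yn\rceil)-\frac{e^{y-1}}{n}\right|\le \frac{C}{n^2}.$$ Consequently $n\,p'_n(\lceil xn\rceil,\lceil yn\rceil)\to e^{y-1}$ as $n\to\infty$; that is, at the point $(x,y)$ the entries that are not beginnings of runs have limiting density $e^{y-1}$, which does not depend on $x$. -/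

import Mathlib

/-- The one-line notation `π₁ π₂ ⋯ πₙ` of a permutation of `{1, …, n}`, as a list of numbers in
`{1, …, n}`.  (The element `a : Fin n` stands for the number `a + 1`.) -/
def oneLine {n : ℕ} (π : Equiv.Perm (Fin n)) : List ℕ :=
  List.ofFn fun a : Fin n => (π a : ℕ) + 1

/-- The (ascending) runs of `π`, i.e. its maximal consecutive increasing subsequences, listed in
the order in which they occur in `π`: the one-line notation is cut exactly between those
neighbouring entries `a`, `b` with `¬ a < b`. -/
def runs {n : ℕ} (π : Equiv.Perm (Fin n)) : List (List ℕ) :=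
  (oneLine π).splitBy fun a b => decide (a < b)

/-- The one-line notation of `runsort π`: sort the runs of `π` into lexicographic order
(the order `≤` on `List ℕ`) and concatenate them. -/
def runsort {n : ℕ} (π : Equiv.Perm (Fin n)) : List ℕ :=
  ((runs π).mergeSort fun r s => decide (r ≤ s)).flatten

/-- Entry `j` is in the `i`-th position of `runsort π` (positions are counted from `1`). -/
def EntryAt {n : ℕ} (π : Equiv.Perm (Fin n)) (i j : ℕ) : Prop :=
  1 ≤ i ∧ (runsort π)[i - 1]? = some j

/-- Entry `j` is the beginning of a run of `π`. -/
def BeginsRun {n : ℕ} (π : Equiv.Perm (Fin n)) (j : ℕ) : Prop :=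
  ∃ r ∈ runs π, r.head? = some j

/-- The probability that a permutation of `n` elements chosen uniformly at random has
property `E`. -/
noncomputable def unifProb (n : ℕ) (E : Equiv.Perm (Fin n) → Prop) : ℝ :=
  (Nat.card {π : Equiv.Perm (Fin n) // E π} : ℝ) / (Nat.card (Equiv.Perm (Fin n)) : ℝ)

/-- The probability `p'ₙ(i, j)` that, for `π` a uniformly random permutation of `{1, …, n}`, the
entry `j` is in the `i`-th position of `runsort π` and is not the beginning of a run of `π`. -/
noncomputable def pInterior (n i j : ℕ) : ℝ :=
  unifProb n fun π => EntryAt π i j ∧ ¬ BeginsRun π j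

/-- The region `{(x, y) ∈ [0,1]² : x < y e^{1-y}}` of the unit square above the curve
`x = y e^{1-y}`. -/
def regionAbove : Set (ℝ × ℝ) :=
  {p | p.1 ∈ Set.Icc (0 : ℝ) 1 ∧ p.2 ∈ Set.Icc (0 : ℝ) 1 ∧ p.1 < p.2 * Real.exp (1 - p.2)}

/-! Write F_n(i,j) = `cdfAt n i j` for the probability that the i-th entry of the sorted word is at
most j. An entry that does not begin a run stands right after a smaller entry c, both in the
permutation and in the sorted word. Deleting it, and renumbering, leaves the relative order of the
other entries in the sorted word unchanged. Conversely, j+1 can be inserted after the i-th sorted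
entry of a smaller permutation exactly when that entry is at most j. Hence p'_{n+1}(i+1,j+1) =
F_n(i,j)/(n+1) exactly (`pInterior_succ`).

Splitting according to the entry at position i+1 gives F_{n+1}(i+1,j) = 1 - (1/(n+1)) ∑_{c=j}^{n}
F_n(i,c) - E, where E is the probability that this entry exceeds j and begins a run. This
discretizes g(y) = 1 - ∫_y^1 g, which is solved by g(y) = e^{y-1}; no term depends on the position,
apart from E.

The event in E forces the runs with beginnings at most j to have at most i entries in total. The
expected share of these entries is about y e^{1-y} = ∑_k y (1-y)^k/k!, where the k-th term accounts
for entries reached from a value at most j by k ascents through larger values. Above the curve this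
exceeds the relative position, and a second-moment bound gives E = O(1/n)
(`exists_unifProb_numInRunsUpTo_le`). The recursion multiplies the old error by at most 1-b < 1, so
induction on i bounds the error by M/(i+1) (`exists_abs_cdfAt_sub_exp_le`). -/

/-! ### Sorting runs as sorting tagged entries -/

/-- Continue the tagging of a word: `h` is the beginning of the current run, `c` the last entry
that was read.  Every further entry is paired with the beginning of its run. -/
def runTagsFrom : ℕ → ℕ → List ℕ → List (ℕ ×ₗ ℕ)
  | _, _, [] => []
  | h, c, d :: l =>
    if c < d then toLex (h, d) :: runTagsFrom h d l else toLex (d, d) :: runTagsFrom d d l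

/-- The entries of a word, each paired with the beginning of its run. -/
def runTags : List ℕ → List (ℕ ×ₗ ℕ)
  | [] => []
  | a :: l => toLex (a, a) :: runTagsFrom a a l

/-- A single run, each entry being paired with the first entry. -/
def tagRun (r : List ℕ) : List (ℕ ×ₗ ℕ) := r.map fun d => toLex (r.headD 0, d)

theorem runTagsFrom_append_of_isChain (h : ℕ) (r v : List ℕ) (c : ℕ)
    (hr : (c :: r).IsChain (· < ·)) :
    runTagsFrom h c (r ++ v) = (r.map fun d => toLex (h, d)) ++
      runTagsFrom h ((c :: r).getLast (by simp)) v := by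
  induction r generalizing c with
  | nil => simp
  | cons d r ih =>
    rw [List.isChain_cons_cons] at hr
    simp [runTagsFrom, hr.1, ih d hr.2]

theorem runTagsFrom_of_not_lt (h c : ℕ) (l : List ℕ) (hl : ∀ d ∈ l.head?, ¬ c < d) :
    runTagsFrom h c l = runTags l := by
  cases l with
  | nil => rfl
  | cons d l => simp_all [runTagsFrom, runTags]

theorem runTags_flatten (m : List (List ℕ)) (h1 : [] ∉ m)
    (h2 : ∀ r ∈ m, r.IsChain (· < ·))
    (h3 : m.IsChain fun a b => ∃ ha hb, ¬ a.getLast ha < b.head hb) :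
    runTags m.flatten = m.flatMap tagRun := by
  induction m with
  | nil => rfl
  | cons r m ih =>
    have ih' := ih (by simp_all) (by simp_all) h3.tail
    cases r with
    | nil => simp at h1
    | cons a r =>
      have hc := h2 (a :: r) (by simp)
      simp only [List.flatten_cons, List.cons_append, runTags, List.flatMap_cons]
      rw [runTagsFrom_append_of_isChain a r _ a hc, runTagsFrom_of_not_lt, ih']
      · simp [tagRun]
      · cases m with
        | nil => simp
        | cons s m =>
          rw [List.isChain_cons_cons] at h3
          obtain ⟨⟨ha, hb, h⟩, -⟩ := h3
          cases s with
          | nil => simp at hb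
          | cons b s => simpa using h

theorem map_snd_tagRun (r : List ℕ) : (tagRun r).map (fun t => (ofLex t).2) = r := by
  simp [tagRun, Function.comp_def]

theorem map_snd_runTagsFrom (h c : ℕ) (l : List ℕ) :
    (runTagsFrom h c l).map (fun t => (ofLex t).2) = l := by
  induction l generalizing h c with
  | nil => rfl
  | cons d l ih =>
    unfold runTagsFrom
    split_ifs <;> simp [ih]

theorem map_snd_runTags (l : List ℕ) : (runTags l).map (fun t => (ofLex t).2) = l := by
  cases l <;> simp [runTags, map_snd_runTagsFrom]

theorem length_runTags (l : List ℕ) : (runTags l).length = l.length := by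
  conv_rhs => rw [← map_snd_runTags l]
  simp

theorem nodup_oneLine {n : ℕ} (π : Equiv.Perm (Fin n)) : (oneLine π).Nodup := by
  unfold oneLine
  rw [List.nodup_ofFn]
  intro a b h
  simpa [Fin.val_inj] using h

theorem length_oneLine {n : ℕ} (π : Equiv.Perm (Fin n)) : (oneLine π).length = n := by
  simp [oneLine]

theorem flatten_runs {n : ℕ} (π : Equiv.Perm (Fin n)) : (runs π).flatten = oneLine π :=
  List.flatten_splitBy _ _

theorem isChain_of_mem_runs {n : ℕ} (π : Equiv.Perm (Fin n)) (r : List ℕ) (hr : r ∈ runs π) :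
    r.IsChain (· < ·) := by
  simpa using List.isChain_of_mem_splitBy hr

theorem runTags_oneLine {n : ℕ} (π : Equiv.Perm (Fin n)) :
    runTags (oneLine π) = (runs π).flatMap tagRun := by
  rw [← flatten_runs, runTags_flatten]
  · exact List.nil_notMem_splitBy _ _
  · exact isChain_of_mem_runs π
  · simpa [runs] using List.isChain_getLast_head_splitBy (fun a b => decide (a < b)) (oneLine π)

/-- The tagged version of `runsort`. -/
def sortedRunTags {n : ℕ} (π : Equiv.Perm (Fin n)) : List (ℕ ×ₗ ℕ) :=
  ((runs π).mergeSort fun r s => decide (r ≤ s)).flatMap tagRun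

theorem sortedRunTags_perm {n : ℕ} (π : Equiv.Perm (Fin n)) :
    (sortedRunTags π).Perm (runTags (oneLine π)) := by
  rw [runTags_oneLine]
  exact (List.mergeSort_perm _ _).flatMap_right _

theorem runsort_eq_map_snd {n : ℕ} (π : Equiv.Perm (Fin n)) :
    runsort π = (sortedRunTags π).map fun t => (ofLex t).2 := by
  unfold runsort sortedRunTags
  rw [List.map_flatMap, List.flatten_eq_flatMap]
  congr 1
  funext r
  exact (map_snd_tagRun r).symm

/-- Distinct runs are disjoint, so their first entries differ and alone decide the lexicographic
order of the runs. Sorting runs therefore amounts to sorting the pairs (beginning, entry). -/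
theorem pairwise_sortedRunTags {n : ℕ} (π : Equiv.Perm (Fin n)) :
    (sortedRunTags π).Pairwise (· < ·) := by
  unfold sortedRunTags
  set m := (runs π).mergeSort fun r s => decide (r ≤ s) with hm
  have hperm : m.Perm (runs π) := List.mergeSort_perm _ _
  have hsort : m.Pairwise (· ≤ ·) := by
    have := List.pairwise_mergeSort (le := fun r s : List ℕ => decide (r ≤ s))
      (by intro a b c; simpa using le_trans) (by intro a b; simpa using le_total a b) (runs π)
    simpa using this
  have hnd : m.flatten.Nodup := by
    rw [hperm.flatten.nodup_iff, flatten_runs]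
    exact nodup_oneLine π
  have hne : ∀ r ∈ m, r ≠ [] := fun r hr =>
    List.ne_nil_of_mem_splitBy (hperm.subset hr)
  rw [List.nodup_flatten] at hnd
  rw [List.pairwise_flatMap]
  constructor
  · intro r hr
    have hc := isChain_of_mem_runs π r (hperm.subset hr)
    rw [List.isChain_iff_pairwise] at hc
    unfold tagRun
    rw [List.pairwise_map]
    exact hc.imp fun {a b} hab => by simp [Prod.Lex.toLex_lt_toLex, hab]
  · refine (hsort.and hnd.2).imp_of_mem ?_
    rintro r s hr hs ⟨hle, hdis⟩ x hx y hy
    obtain ⟨a, r, rfl⟩ := List.exists_cons_of_ne_nil (hne r hr)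
    obtain ⟨b, s, rfl⟩ := List.exists_cons_of_ne_nil (hne s hs)
    have hab : a ≠ b := fun h => hdis (a := a) (by simp) (by simp [h])
    have hlt : a < b := by
      by_contra hba
      exact hle.not_gt (List.Lex.rel (lt_of_le_of_ne (not_lt.1 hba) hab.symm))
    simp only [tagRun, List.mem_map] at hx hy
    obtain ⟨d, -, rfl⟩ := hx
    obtain ⟨e, -, rfl⟩ := hy
    simp [Prod.Lex.toLex_lt_toLex, hlt]

/-- A position in a strictly sorted list is a count of smaller elements. Counts are invariant under
rearrangement, so positions in `runsort` can be read off from the unsorted word. -/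
theorem getElem?_eq_some_iff_countP {α : Type*} [LinearOrder α] (s : List α)
    (hs : s.Pairwise (· < ·)) (i : ℕ) (t : α) :
    s[i]? = some t ↔ t ∈ s ∧ s.countP (fun u => decide (u < t)) = i := by
  induction s generalizing i with
  | nil => simp
  | cons a s ih =>
    rw [List.pairwise_cons] at hs
    have ih := ih hs.2
    cases i with
    | zero =>
      simp only [List.getElem?_cons_zero, Option.some.injEq, List.mem_cons, List.countP_eq_zero,
        decide_eq_true_eq]
      constructor
      · rintro rfl
        refine ⟨Or.inl rfl, ?_⟩
        rintro b (rfl | hb)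
        · exact lt_irrefl _
        · exact (hs.1 b hb).le.not_gt
      · rintro ⟨rfl | h, h'⟩
        · rfl
        · exact absurd (hs.1 t h) (h' a (Or.inl rfl))
    | succ i =>
      rw [List.getElem?_cons_succ, ih, List.countP_cons]
      constructor
      · rintro ⟨h, h'⟩
        simp [h, h', hs.1 t h]
      · rintro ⟨h, h'⟩
        rcases List.mem_cons.1 h with rfl | h
        · exfalso
          have : s.countP (fun u => decide (u < t)) = 0 := by
            rw [List.countP_eq_zero]
            intro b hb
            simpa using (hs.1 b hb).le
          simp [this] at h'
        · refine ⟨h, ?_⟩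
          simpa [hs.1 t h] using h'

theorem entryAt_iff {n : ℕ} (π : Equiv.Perm (Fin n)) (i j : ℕ) :
    EntryAt π i j ↔ ∃ t ∈ runTags (oneLine π), (ofLex t).2 = j ∧
      (runTags (oneLine π)).countP (fun u => decide (u < t)) + 1 = i := by
  unfold EntryAt
  rw [runsort_eq_map_snd, List.getElem?_map, Option.map_eq_some_iff]
  have hp := sortedRunTags_perm π
  constructor
  · rintro ⟨hi, t, ht, hj⟩
    rw [getElem?_eq_some_iff_countP _ (pairwise_sortedRunTags π), hp.mem_iff, hp.countP_eq] at ht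
    exact ⟨t, ht.1, hj, by omega⟩
  · rintro ⟨t, ht, hj, hi⟩
    refine ⟨by omega, t, ?_, hj⟩
    rw [getElem?_eq_some_iff_countP _ (pairwise_sortedRunTags π), hp.mem_iff, hp.countP_eq]
    exact ⟨ht, by omega⟩

theorem length_runsort {n : ℕ} (π : Equiv.Perm (Fin n)) : (runsort π).length = n := by
  rw [runsort_eq_map_snd, List.length_map, (sortedRunTags_perm π).length_eq, length_runTags,
    length_oneLine]

theorem beginsRun_iff {n : ℕ} (π : Equiv.Perm (Fin n)) (j : ℕ) :
    BeginsRun π j ↔ toLex (j, j) ∈ runTags (oneLine π) := by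
  unfold BeginsRun
  rw [runTags_oneLine, List.mem_flatMap]
  refine exists_congr fun r => and_congr_right fun hr => ?_
  obtain ⟨a, r, rfl⟩ := List.exists_cons_of_ne_nil (List.ne_nil_of_mem_splitBy hr)
  simp only [tagRun, List.head?_cons, Option.some.injEq, List.mem_map, List.headD_cons]
  constructor
  · rintro rfl
    exact ⟨a, by simp, rfl⟩
  · rintro ⟨d, -, h⟩
    exact congrArg (fun t => (ofLex t).1) h

theorem EntryAt.unique {n : ℕ} {π : Equiv.Perm (Fin n)} {i j k : ℕ} (h : EntryAt π i j)
    (h' : EntryAt π i k) : j = k :=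
  Option.some_injective _ (h.2.symm.trans h'.2)

theorem exists_entryAt {n : ℕ} (π : Equiv.Perm (Fin n)) (i : ℕ) (h1 : 1 ≤ i) (hn : i ≤ n) :
    ∃ j, EntryAt π i j := by
  have h : i - 1 < (runsort π).length := by rw [length_runsort]; omega
  exact ⟨(runsort π)[i - 1], h1, List.getElem?_eq_getElem h⟩

theorem mem_oneLine {n : ℕ} {π : Equiv.Perm (Fin n)} {j : ℕ} :
    j ∈ oneLine π ↔ 1 ≤ j ∧ j ≤ n := by
  simp only [oneLine, List.mem_ofFn]
  constructor
  · rintro ⟨a, rfl⟩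
    have := (π a).isLt
    omega
  · rintro ⟨h1, h2⟩
    exact ⟨π.symm ⟨j - 1, by omega⟩, by simp; omega⟩

theorem EntryAt.mem {n : ℕ} {π : Equiv.Perm (Fin n)} {i j : ℕ} (h : EntryAt π i j) :
    1 ≤ j ∧ j ≤ n := by
  obtain ⟨t, ht, rfl, -⟩ := (entryAt_iff π i j).1 h
  apply mem_oneLine.1
  have h' := List.mem_map_of_mem (f := fun t => (ofLex t).2) ht
  rwa [map_snd_runTags] at h'

/-! ### Effect of an insertion on tags and positions -/

/-- Tagging reads from left to right, so `A` and `h` serve for every continuation `v`; this lets the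
words with and without the inserted entry be compared. -/
theorem runTags_append_cons (u : List ℕ) (c : ℕ) : ∃ (h : ℕ) (A : List (ℕ ×ₗ ℕ)),
    (∀ v, runTags (u ++ c :: v) = A ++ toLex (h, c) :: runTagsFrom h c v) ∧
    (∀ t ∈ A, (ofLex t).1 ∈ u) ∧ (h ∈ u ∨ h = c) ∧ h ≤ c ∧
    ((u ++ [c]).Nodup → ∀ t ∈ A, (ofLex t).1 = h → (ofLex t).2 < c) := by
  induction u using List.reverseRecOn generalizing c with
  | nil => exact ⟨c, [], by simp [runTags]⟩
  | append_singleton u b ih =>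
    obtain ⟨h, A, h1, h2, h3, h4, h5⟩ := ih b
    by_cases hbc : b < c
    · refine ⟨h, A ++ [toLex (h, b)], ?_, ?_, ?_, h4.trans hbc.le, ?_⟩
      · intro v
        simp [h1, runTagsFrom, hbc]
      · intro t ht
        simp only [List.mem_append, List.mem_singleton] at ht ⊢
        rcases ht with ht | rfl
        · exact Or.inl (h2 t ht)
        · simpa using h3
      · simp only [List.mem_append, List.mem_singleton]
        exact Or.inl h3
      · intro hnd t ht hth
        simp only [List.mem_append, List.mem_singleton] at ht
        rcases ht with ht | rfl
        · exact (h5 (List.nodup_append.1 hnd).1 t ht hth).trans hbc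
        · simpa using hbc
    · refine ⟨c, A ++ [toLex (h, b)], ?_, ?_, Or.inr rfl, le_rfl, ?_⟩
      · intro v
        simp [h1, runTagsFrom, hbc]
      · intro t ht
        simp only [List.mem_append, List.mem_singleton] at ht ⊢
        rcases ht with ht | rfl
        · exact Or.inl (h2 t ht)
        · simpa using h3
      · intro hnd t ht hth
        exfalso
        have hc : c ∉ u ++ [b] := fun hc =>
          (List.nodup_append.1 hnd).2.2 c hc c (by simp) rfl
        simp only [List.mem_append, List.mem_singleton] at ht hc
        rcases ht with ht | rfl
        · exact hc (Or.inl (hth ▸ h2 t ht))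
        · exact hc (by simpa [← hth] using h3)

theorem fst_mem_runTagsFrom {h c : ℕ} {l : List ℕ} {t : ℕ ×ₗ ℕ} (ht : t ∈ runTagsFrom h c l) :
    (ofLex t).1 = h ∨ (ofLex t).1 ∈ l := by
  induction l generalizing h c with
  | nil => simp [runTagsFrom] at ht
  | cons d l ih =>
    unfold runTagsFrom at ht
    split_ifs at ht
    all_goals
      rcases List.mem_cons.1 ht with rfl | ht
      · simp
      · have := ih ht
        simp only [List.mem_cons]
        tauto

theorem lt_snd_of_mem_runTagsFrom {h c : ℕ} {l : List ℕ} (hl : h ∉ l) {t : ℕ ×ₗ ℕ}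
    (ht : t ∈ runTagsFrom h c l) (hth : (ofLex t).1 = h) : c < (ofLex t).2 := by
  induction l generalizing c with
  | nil => simp [runTagsFrom] at ht
  | cons d l ih =>
    simp only [List.mem_cons, not_or] at hl
    unfold runTagsFrom at ht
    split_ifs at ht with hcd
    · rcases List.mem_cons.1 ht with rfl | ht
      · simpa using hcd
      · exact hcd.trans (ih hl.2 ht)
    · exfalso
      rcases List.mem_cons.1 ht with rfl | ht
      · exact hl.1 hth.symm
      · rcases fst_mem_runTagsFrom ht with h' | h'
        · exact hl.1 (hth.symm.trans h')
        · exact hl.2 (hth ▸ h')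

theorem fst_ne_of_mem_restart {h d : ℕ} {l : List ℕ} (hl : h ∉ d :: l) {t : ℕ ×ₗ ℕ}
    (ht : t ∈ toLex (d, d) :: runTagsFrom d d l) : (ofLex t).1 ≠ h := by
  rintro rfl
  rcases List.mem_cons.1 ht with rfl | ht
  · exact hl List.mem_cons_self
  · exact hl (by simpa using fst_mem_runTagsFrom ht)

theorem countP_lt_congr {h j c : ℕ} {s : List (ℕ ×ₗ ℕ)}
    (hs : ∀ t ∈ s, (ofLex t).1 = h → ((ofLex t).2 < j ↔ (ofLex t).2 < c)) :
    s.countP (fun u => decide (u < toLex (h, j))) =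
      s.countP (fun u => decide (u < toLex (h, c))) := by
  apply List.countP_congr
  intro t ht
  have := hs t ht
  simp only [Prod.Lex.lt_iff, ofLex_toLex, decide_eq_true_eq]
  tauto

/-- Until the next descent neither side counts anything: the tag `g` is too large on the left, the
entries exceed `c` on the right. From the descent on the two taggings agree and `h` no longer occurs
as a tag. -/
theorem countP_runTagsFrom_of_lt {h c j g d : ℕ} (hhg : h < g) (hcd : c < d)
    (l : List ℕ) (hl : h ∉ l) :
    (runTagsFrom g d l).countP (fun u => decide (u < toLex (h, j))) =
      (runTagsFrom h d l).countP (fun u => decide (u < toLex (h, c))) := by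
  induction l generalizing d with
  | nil => rfl
  | cons e l ih =>
    have hl' : h ∉ l := fun h' => hl (List.mem_cons_of_mem _ h')
    unfold runTagsFrom
    split_ifs with hde
    · rw [List.countP_cons, List.countP_cons, ih (hcd.trans hde) hl']
      simp [Prod.Lex.toLex_lt_toLex, hhg.not_gt, hhg.ne', (hcd.trans hde).not_gt]
    · exact countP_lt_congr fun t ht hth => absurd hth (fst_ne_of_mem_restart hl ht)

theorem countP_runTagsFrom_insert {h c j : ℕ} (hhc : h ≤ c) (hcj : c < j) (v : List ℕ)
    (hv : h ∉ v) (hj : j ∉ v) :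
    (runTagsFrom h j v).countP (fun u => decide (u < toLex (h, j))) =
      (runTagsFrom h c v).countP (fun u => decide (u < toLex (h, c))) := by
  cases v with
  | nil => rfl
  | cons d v =>
    have hv' : h ∉ v := fun h' => hv (List.mem_cons_of_mem _ h')
    have hdj : d ≠ j := fun h => hj (by simp [h])
    unfold runTagsFrom
    rcases lt_or_ge c d with hcd | hcd
    · rw [if_pos hcd]
      rcases lt_or_gt_of_ne hdj with hdj | hdj
      -- With c < d < j the insertion cuts the run of c, and its remainder gets the tag d > h. That
      -- remainder came after c before and comes after j now.
      · rw [if_neg hdj.not_gt, List.countP_cons, List.countP_cons,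
          countP_runTagsFrom_of_lt (hhc.trans_lt hcd) hcd v hv']
        simp [Prod.Lex.toLex_lt_toLex, (hhc.trans_lt hcd).not_gt, (hhc.trans_lt hcd).ne',
          hcd.not_gt]
      · rw [if_pos hdj]
        refine countP_lt_congr fun t ht hth => ?_
        have : d ≤ (ofLex t).2 := by
          rcases List.mem_cons.1 ht with rfl | ht
          · exact le_rfl
          · exact (lt_snd_of_mem_runTagsFrom hv' ht hth).le
        omega
    · rw [if_neg hcd.not_gt, if_neg (hcd.trans_lt hcj).not_gt]
      exact countP_lt_congr fun t ht hth => absurd hth (fst_ne_of_mem_restart hv ht)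

/-- The entry `j` is in the `i`-th position after the runs of the word `l` have been sorted. -/
def PlacedAt (l : List ℕ) (i j : ℕ) : Prop :=
  ∃ t ∈ runTags l, (ofLex t).2 = j ∧ (runTags l).countP (fun u => decide (u < t)) + 1 = i

theorem eq_of_mem_runTags {l : List ℕ} (hl : l.Nodup) {s t : ℕ ×ₗ ℕ} (hs : s ∈ runTags l)
    (ht : t ∈ runTags l) (hst : (ofLex s).2 = (ofLex t).2) : s = t := by
  rw [← map_snd_runTags l] at hl
  exact List.inj_on_of_nodup_map hl hs ht hst

theorem placedAt_iff {l : List ℕ} (hl : l.Nodup) {t : ℕ ×ₗ ℕ} (ht : t ∈ runTags l) (i : ℕ) :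
    PlacedAt l i (ofLex t).2 ↔ (runTags l).countP (fun u => decide (u < t)) + 1 = i := by
  constructor
  · rintro ⟨s, hs, hst, h⟩
    rwa [eq_of_mem_runTags hl hs ht hst] at h
  · exact fun h => ⟨t, ht, rfl, h⟩

theorem nodup_insert {u v : List ℕ} {c j : ℕ} (hnd : (u ++ c :: v).Nodup)
    (hj : j ∉ u ++ c :: v) : (u ++ c :: j :: v).Nodup := by
  have h : (u ++ c :: j :: v).Perm (j :: (u ++ c :: v)) := by
    have := List.perm_middle (a := j) (l₁ := u ++ [c]) (l₂ := v)
    simpa using this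
  rw [h.nodup_iff]
  exact List.nodup_cons.2 ⟨hj, hnd⟩

/-- Inserting `j` right after a smaller entry `c` puts it right after `c` in the sorted word too,
and `j` does not begin a run. -/
theorem placedAt_insert {u v : List ℕ} {c j : ℕ} (hnd : (u ++ c :: v).Nodup)
    (hj : j ∉ u ++ c :: v) (hcj : c < j) (i : ℕ) :
    (PlacedAt (u ++ c :: j :: v) (i + 1) j ↔ PlacedAt (u ++ c :: v) i c) ∧
      toLex (j, j) ∉ runTags (u ++ c :: j :: v) := by
  obtain ⟨h, A, h1, h2, h3, h4, h5⟩ := runTags_append_cons u c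
  have hnd' := nodup_insert hnd hj
  have hnew : runTags (u ++ c :: j :: v) =
      A ++ toLex (h, c) :: toLex (h, j) :: runTagsFrom h j v := by
    rw [h1, runTagsFrom, if_pos hcj]
  have hjmem : toLex (h, j) ∈ runTags (u ++ c :: j :: v) := by simp [hnew]
  have hcmem : toLex (h, c) ∈ runTags (u ++ c :: v) := by simp [h1]
  constructor
  · have e1 := placedAt_iff hnd' hjmem (i + 1)
    have e2 := placedAt_iff hnd hcmem i
    simp only [ofLex_toLex] at e1 e2
    rw [e1, e2, hnew, h1]
    have huc : (u ++ [c]).Nodup := hnd.sublist (by simp)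
    have hv : h ∉ v := by
      intro hv
      rcases h3 with h3 | rfl
      · exact (List.nodup_append.1 hnd).2.2 h h3 h (by simp [hv]) rfl
      · exact (List.nodup_cons.1 (List.nodup_append.1 hnd).2.1).1 hv
    have hA : A.countP (fun u => decide (u < toLex (h, j))) =
        A.countP (fun u => decide (u < toLex (h, c))) :=
      countP_lt_congr fun t ht hth => by
        have := h5 huc t ht hth
        omega
    have hjv : j ∉ v := fun h => hj (by simp [h])
    have htail := countP_runTagsFrom_insert h4 hcj v hv hjv
    simp only [List.countP_append, List.countP_cons, hA, htail]
    simp [Prod.Lex.toLex_lt_toLex, hcj]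
    omega
  · intro hmem
    have := congrArg (fun t => (ofLex t).1) (eq_of_mem_runTags hnd' hmem hjmem rfl)
    simp only [ofLex_toLex] at this
    omega

theorem mem_runTags_insert_of_not_lt {u v : List ℕ} {c j : ℕ} (hcj : ¬ c < j) :
    toLex (j, j) ∈ runTags (u ++ c :: j :: v) := by
  obtain ⟨h, A, h1, -⟩ := runTags_append_cons u c
  simp [h1, runTagsFrom, hcj]

theorem runTagsFrom_map {f : ℕ → ℕ} (hf : StrictMono f) (h c : ℕ) (l : List ℕ) :
    runTagsFrom (f h) (f c) (l.map f) =
      (runTagsFrom h c l).map fun t => toLex (f (ofLex t).1, f (ofLex t).2) := by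
  induction l generalizing h c with
  | nil => rfl
  | cons d l ih =>
    simp only [List.map_cons, runTagsFrom, hf.lt_iff_lt, ih]
    split_ifs <;> rfl

theorem runTags_map {f : ℕ → ℕ} (hf : StrictMono f) (l : List ℕ) :
    runTags (l.map f) = (runTags l).map fun t => toLex (f (ofLex t).1, f (ofLex t).2) := by
  cases l with
  | nil => rfl
  | cons a l => simp [runTags, runTagsFrom_map hf]

theorem placedAt_map {f : ℕ → ℕ} (hf : StrictMono f) (l : List ℕ) (i j : ℕ) :
    PlacedAt (l.map f) i (f j) ↔ PlacedAt l i j := by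
  unfold PlacedAt
  simp only [runTags_map hf, List.mem_map, exists_exists_and_eq_and, List.countP_map,
    Function.comp_def, ofLex_toLex, hf.injective.eq_iff]
  refine exists_congr fun t => and_congr_right fun _ => and_congr_right fun _ => ?_
  have : ∀ u : ℕ ×ₗ ℕ, toLex (f (ofLex u).1, f (ofLex u).2) < toLex (f (ofLex t).1, f (ofLex t).2)
      ↔ u < t := fun u => by
    simp [Prod.Lex.lt_iff, hf.lt_iff_lt, hf.injective.eq_iff]
  simp only [this]

/-! ### The exact formula for non-beginnings -/

/-- Insert the value `j` at position `q` into the word of `σ`, moving up the values from `j` on. -/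
def insertPerm {n : ℕ} (j q : Fin (n + 1)) (σ : Equiv.Perm (Fin n)) : Equiv.Perm (Fin (n + 1)) :=
  (finSuccEquiv' q).trans ((Equiv.optionCongr σ).trans (finSuccEquiv' j).symm)

theorem insertPerm_self {n : ℕ} (j q : Fin (n + 1)) (σ : Equiv.Perm (Fin n)) :
    insertPerm j q σ q = j := by
  simp [insertPerm]

theorem insertPerm_succAbove {n : ℕ} (j q : Fin (n + 1)) (σ : Equiv.Perm (Fin n)) (a : Fin n) :
    insertPerm j q σ (q.succAbove a) = j.succAbove (σ a) := by
  simp [insertPerm]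

theorem bijective_insertPerm {n : ℕ} (j : Fin (n + 1)) :
    Function.Bijective fun p : Fin (n + 1) × Equiv.Perm (Fin n) => insertPerm j p.1 p.2 := by
  rw [Fintype.bijective_iff_injective_and_card]
  constructor
  · rintro ⟨q, σ⟩ ⟨q', σ'⟩ h
    simp only at h
    have hq : q = q' := by
      apply (insertPerm j q σ).injective
      rw [insertPerm_self, h, insertPerm_self]
    subst hq
    congr 1
    ext1 a
    apply Fin.succAbove_right_injective (p := j)
    rw [← insertPerm_succAbove j q σ, h, insertPerm_succAbove]
  · simp [Fintype.card_perm, Nat.factorial_succ]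

/-- The order embedding of the numbers other than `j + 1`. -/
def skipValue (j v : ℕ) : ℕ := if v ≤ j then v else v + 1

theorem strictMono_skipValue (j : ℕ) : StrictMono (skipValue j) := by
  intro a b h
  unfold skipValue
  split_ifs <;> omega

theorem skipValue_ne (j v : ℕ) : skipValue j v ≠ j + 1 := by
  unfold skipValue
  split_ifs <;> omega

theorem skipValue_lt_iff (j v : ℕ) : skipValue j v < j + 1 ↔ v ≤ j := by
  unfold skipValue
  split_ifs <;> omega

theorem oneLine_insertPerm {n : ℕ} (j q : Fin (n + 1)) (σ : Equiv.Perm (Fin n)) :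
    oneLine (insertPerm j q σ) =
      ((oneLine σ).map (skipValue j)).take q ++
        (j + 1 : ℕ) :: ((oneLine σ).map (skipValue j)).drop q := by
  have hq := q.isLt
  apply List.ext_getElem
  · simp [oneLine]
    omega
  · intro k hk hk'
    have hkn : k < n + 1 := by simpa [oneLine] using hk
    have hl : (((oneLine σ).map (skipValue j)).take q).length = q := by
      simp [oneLine]
      omega
    rcases lt_trichotomy k q with h | h | h
    · rw [List.getElem_append_left (by omega)]
      have e : (⟨k, hkn⟩ : Fin (n + 1)) = q.succAbove ⟨k, by omega⟩ := by
        rw [Fin.succAbove_of_castSucc_lt _ _ (by simpa [Fin.lt_def] using h)]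
        rfl
      simp only [oneLine, List.getElem_ofFn, List.getElem_take, List.getElem_map, e,
        insertPerm_succAbove]
      simp only [skipValue, Fin.succAbove, Fin.lt_def, Fin.val_castSucc]
      split_ifs <;> simp <;> omega
    · rw [List.getElem_append_right (by omega)]
      have e : (⟨k, hkn⟩ : Fin (n + 1)) = q := Fin.ext h
      have e2 : k - (((oneLine σ).map (skipValue j)).take q).length = 0 := by omega
      simp only [e2, List.getElem_cons_zero]
      simp only [oneLine, List.getElem_ofFn, e, insertPerm_self]
    · rw [List.getElem_append_right (by omega)]
      have e : (⟨k, hkn⟩ : Fin (n + 1)) = q.succAbove ⟨k - 1, by omega⟩ := by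
        rw [Fin.succAbove_of_le_castSucc _ _ (by simp [Fin.le_def]; omega)]
        ext
        simp
        omega
      have e2 : k - (((oneLine σ).map (skipValue j)).take q).length = (k - 1 - q) + 1 := by omega
      have e3 : q + (k - 1 - q) = k - 1 := by omega
      simp only [e2, List.getElem_cons_succ, List.getElem_drop, e3]
      simp only [oneLine, List.getElem_ofFn, List.getElem_map, e, insertPerm_succAbove]
      simp only [skipValue, Fin.succAbove, Fin.lt_def, Fin.val_castSucc]
      split_ifs <;> simp <;> omega

theorem interior_insertPerm_iff {n : ℕ} (j q : Fin (n + 1)) (σ : Equiv.Perm (Fin n)) (i : ℕ) :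
    (EntryAt (insertPerm j q σ) (i + 1) (j + 1) ∧ ¬ BeginsRun (insertPerm j q σ) (j + 1)) ↔
      ∃ k : Fin n, (q : ℕ) = k + 1 ∧ EntryAt σ i (σ k + 1) ∧ (σ k : ℕ) + 1 ≤ j := by
  have hE : ∀ {m : ℕ} (τ : Equiv.Perm (Fin m)) (a b : ℕ),
      EntryAt τ a b ↔ PlacedAt (oneLine τ) a b := fun τ a b => entryAt_iff τ a b
  rw [beginsRun_iff, hE, oneLine_insertPerm]
  set l := (oneLine σ).map (skipValue j) with hl
  have hlen : l.length = n := by simp [hl, oneLine]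
  -- Inserted at the front, the new value always begins a run; otherwise everything depends on its
  -- left neighbour.
  rcases Nat.eq_zero_or_pos q with hq | hq
  · simp only [hq, List.take_zero, List.nil_append, runTags, List.mem_cons, true_or, not_true,
      and_false, false_iff]
    rintro ⟨k, hk, -⟩
    omega
  · have hkn : (q : ℕ) - 1 < n := by omega
    have hc : l[(q : ℕ) - 1]'(by omega) = skipValue j (σ ⟨q - 1, hkn⟩ + 1) := by
      simp [hl, oneLine]
    have ht : l.take q = l.take (q - 1) ++ [l[(q : ℕ) - 1]'(by omega)] := by
      conv_lhs => rw [show (q : ℕ) = (q - 1) + 1 by omega]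
      exact List.take_succ_eq_append_getElem (by omega)
    have hsplit : l.take (q - 1) ++ l[(q : ℕ) - 1]'(by omega) :: l.drop q = l := by
      have h := List.take_append_drop q l
      rw [ht] at h
      simpa only [List.append_assoc, List.singleton_append] using h
    have hnd : l.Nodup :=
      (nodup_oneLine σ).map (strictMono_skipValue j).injective
    have hj : (j : ℕ) + 1 ∉ l := by
      simp only [hl, List.mem_map, not_exists, not_and]
      exact fun v _ => skipValue_ne j v
    rw [ht, List.append_assoc, List.singleton_append]
    have hR : (∃ k : Fin n, (q : ℕ) = k + 1 ∧ EntryAt σ i (σ k + 1) ∧ (σ k : ℕ) + 1 ≤ j) ↔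
        EntryAt σ i (σ ⟨q - 1, hkn⟩ + 1) ∧ (σ ⟨q - 1, hkn⟩ : ℕ) + 1 ≤ j := by
      constructor
      · rintro ⟨k, hk, h⟩
        have : k = ⟨q - 1, hkn⟩ := Fin.ext (by simp; omega)
        rwa [← this]
      · exact fun h => ⟨_, by simp; omega, h⟩
    rw [hR, hc]
    rw [hc] at hsplit
    by_cases hlt : skipValue j (σ ⟨q - 1, hkn⟩ + 1) < j + 1
    · have := placedAt_insert (by rwa [hsplit]) (by rwa [hsplit]) hlt i
      rw [hsplit] at this
      rw [this.1, hE, hl, placedAt_map (strictMono_skipValue j), ← hl]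
      have h2 := (skipValue_lt_iff _ _).1 hlt
      simp only [this.2, h2, not_false_iff, and_true]
    · have h1 := mem_runTags_insert_of_not_lt (u := l.take (q - 1)) (v := l.drop q) hlt
      have h2 := mt (skipValue_lt_iff _ _).2 hlt
      simp only [h1, h2, not_true, and_false]

/-- The probability that the `i`-th entry of `runsort σ` is at most `j`. -/
noncomputable def cdfAt (n i j : ℕ) : ℝ := unifProb n fun σ => ∃ c ≤ j, EntryAt σ i c

/-- A permutation whose i-th sorted entry is at most j admits exactly one suitable insertion place,
right after that entry. The numerators thus agree, and (n+1)!/n! supplies the factor n+1. -/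
theorem pInterior_succ (n i j : ℕ) (hj : j ≤ n) :
    pInterior (n + 1) (i + 1) (j + 1) = cdfAt n i j / (n + 1) := by
  have key : Nat.card {π : Equiv.Perm (Fin (n + 1)) //
      EntryAt π (i + 1) (j + 1) ∧ ¬ BeginsRun π (j + 1)} =
      Nat.card {σ : Equiv.Perm (Fin n) // ∃ c ≤ j, EntryAt σ i c} := by
    set J : Fin (n + 1) := ⟨j, by omega⟩
    have e := (Equiv.ofBijective _ (bijective_insertPerm J)).subtypeEquiv
      (p := fun p => ∃ k : Fin n, (p.1 : ℕ) = k + 1 ∧ EntryAt p.2 i (p.2 k + 1) ∧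
        (p.2 k : ℕ) + 1 ≤ j)
      (q := fun π => EntryAt π (i + 1) (j + 1) ∧ ¬ BeginsRun π (j + 1))
      (fun p => (interior_insertPerm_iff J p.1 p.2 i).symm)
    rw [← Nat.card_congr e]
    refine Nat.card_eq_of_bijective
      (fun p => ⟨p.1.2, by
        obtain ⟨k, -, h1, h2⟩ := p.2
        exact ⟨_, h2, h1⟩⟩) ⟨?_, ?_⟩
    · rintro ⟨⟨q, σ⟩, k, hk, h1, h2⟩ ⟨⟨q', σ'⟩, k', hk', h1', h2'⟩ h
      obtain rfl : σ = σ' := congrArg Subtype.val h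
      have hkk : k = k' := by
        apply σ.injective
        have : (σ k : ℕ) + 1 = σ k' + 1 := h1.unique h1'
        exact Fin.ext (by omega)
      subst hkk
      simp only [Subtype.mk.injEq, Prod.mk.injEq, and_true]
      exact Fin.ext (hk.trans hk'.symm)
    · rintro ⟨σ, c, hc, h⟩
      have hcm := h.mem
      refine ⟨⟨⟨(σ.symm ⟨c - 1, by omega⟩).succ, σ⟩, σ.symm ⟨c - 1, by omega⟩, by simp, ?_, ?_⟩, rfl⟩
      · simpa [show c - 1 + 1 = c by omega] using h
      · simp
        omega
  unfold pInterior cdfAt unifProb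
  rw [key]
  simp only [Nat.card_eq_fintype_card, Fintype.card_perm, Fintype.card_fin, Nat.factorial_succ]
  push_cast
  rw [div_div, mul_comm]

/-! ### Averages over permutations -/

/-- The mean of `f π` over all permutations `π` of `n` elements. -/
noncomputable def permMean (n : ℕ) (f : Equiv.Perm (Fin n) → ℝ) : ℝ :=
  (∑ π, f π) / (n.factorial : ℝ)

theorem unifProb_eq_permMean (n : ℕ) (E : Equiv.Perm (Fin n) → Prop) [DecidablePred E] :
    unifProb n E = permMean n fun π => if E π then 1 else 0 := by
  unfold unifProb permMean
  rw [Finset.sum_boole, Nat.card_eq_fintype_card, Nat.card_eq_fintype_card, Fintype.card_perm,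
    Fintype.card_fin, Fintype.card_subtype]

theorem permMean_mono {n : ℕ} {f g : Equiv.Perm (Fin n) → ℝ} (h : ∀ π, f π ≤ g π) :
    permMean n f ≤ permMean n g := by
  unfold permMean
  gcongr
  exact h _

theorem permMean_const (n : ℕ) (c : ℝ) : permMean n (fun _ => c) = c := by
  unfold permMean
  have : (n.factorial : ℝ) ≠ 0 := by positivity
  simp [Fintype.card_perm, this]

theorem permMean_add {n : ℕ} (f g : Equiv.Perm (Fin n) → ℝ) :
    permMean n (fun π => f π + g π) = permMean n f + permMean n g := by
  simp [permMean, Finset.sum_add_distrib, add_div]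

theorem permMean_const_mul {n : ℕ} (c : ℝ) (f : Equiv.Perm (Fin n) → ℝ) :
    permMean n (fun π => c * f π) = c * permMean n f := by
  rw [permMean, permMean, ← Finset.mul_sum, mul_div_assoc]

theorem permMean_sum {n : ℕ} {ι : Type*} (s : Finset ι) (f : ι → Equiv.Perm (Fin n) → ℝ) :
    permMean n (fun π => ∑ a ∈ s, f a π) = ∑ a ∈ s, permMean n (f a) := by
  unfold permMean
  rw [Finset.sum_comm, Finset.sum_div]

theorem unifProb_nonneg (n : ℕ) (E : Equiv.Perm (Fin n) → Prop) : 0 ≤ unifProb n E := by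
  unfold unifProb
  positivity

theorem unifProb_mono {n : ℕ} {E E' : Equiv.Perm (Fin n) → Prop} (h : ∀ π, E π → E' π) :
    unifProb n E ≤ unifProb n E' := by
  classical
  rw [unifProb_eq_permMean, unifProb_eq_permMean]
  refine permMean_mono fun π => ?_
  by_cases hE : E π
  · simp [hE, h π hE]
  · rw [if_neg hE]
    split_ifs <;> norm_num

theorem unifProb_le_one (n : ℕ) (E : Equiv.Perm (Fin n) → Prop) : unifProb n E ≤ 1 := by
  classical
  rw [unifProb_eq_permMean]
  refine (permMean_mono (g := fun _ => 1) fun π => ?_).trans (permMean_const n 1).le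
  split_ifs <;> norm_num

/-! ### The recursion for the distribution function -/

/-- The number of entries of `π` that lie in a run with a beginning that is at most `j`. -/
def numInRunsUpTo {n : ℕ} (π : Equiv.Perm (Fin n)) (j : ℕ) : ℕ :=
  (runTags (oneLine π)).countP fun t => decide ((ofLex t).1 ≤ j)

/-- All entries of runs with beginnings at most j < c come before the beginning c in the sorted
word, hence occupy positions below i. -/
theorem numInRunsUpTo_lt {n : ℕ} {π : Equiv.Perm (Fin n)} {i j c : ℕ} (hjc : j < c)
    (h : EntryAt π i c) (hb : BeginsRun π c) : numInRunsUpTo π j < i := by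
  have h1 := (placedAt_iff (nodup_oneLine π) ((beginsRun_iff π c).1 hb) i).1
    ((entryAt_iff π i c).1 h)
  rw [← h1, Nat.lt_succ_iff]
  apply List.countP_mono_left
  intro t _ ht
  simp only [decide_eq_true_eq] at ht ⊢
  rw [Prod.Lex.lt_iff]
  exact Or.inl (by simpa using by omega)

theorem one_sub_cdfAt_bounds {n i j : ℕ} (h1 : 1 ≤ i) (hn : i ≤ n) :
    0 ≤ 1 - cdfAt n i j - ∑ c ∈ Finset.Ioc j n, pInterior n i c ∧
      1 - cdfAt n i j - ∑ c ∈ Finset.Ioc j n, pInterior n i c ≤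
        unifProb n fun π => numInRunsUpTo π j < i := by
  classical
  -- Exactly one entry d occupies position i: either d ≤ j, or d > j is not a beginning, or d > j is
  -- a beginning.
  have key : 1 = cdfAt n i j + ∑ c ∈ Finset.Ioc j n, pInterior n i c +
      unifProb n fun π => ∃ c, j < c ∧ EntryAt π i c ∧ BeginsRun π c := by
    unfold cdfAt pInterior
    simp only [unifProb_eq_permMean]
    rw [← permMean_sum, ← permMean_add, ← permMean_add]
    conv_lhs => rw [← permMean_const n 1]
    congr 1
    funext π
    obtain ⟨d, hd⟩ := exists_entryAt π i h1 hn
    have hu : ∀ c, EntryAt π i c ↔ c = d := fun c => ⟨fun h => h.unique hd, fun h => h ▸ hd⟩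
    have hdn := hd.mem.2
    simp only [hu, exists_eq_right, ite_and, Finset.sum_ite_eq', Finset.mem_Ioc, hdn, and_true]
    have e3 : (∃ c, j < c ∧ c = d ∧ BeginsRun π c) ↔ j < d ∧ BeginsRun π d :=
      ⟨by rintro ⟨c, h, rfl, h'⟩; exact ⟨h, h'⟩, fun h => ⟨d, h.1, rfl, h.2⟩⟩
    rw [e3]
    by_cases hb : BeginsRun π d <;> by_cases h : j < d
    · simp [hb, h, not_le.2 h]
    · simp [h, not_lt.1 h]
    · simp [hb, h, not_le.2 h]
    · simp [h, not_lt.1 h]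
  have hle : unifProb n (fun π => ∃ c, j < c ∧ EntryAt π i c ∧ BeginsRun π c) ≤
      unifProb n fun π => numInRunsUpTo π j < i :=
    unifProb_mono fun π ⟨c, hc, h, hb⟩ => numInRunsUpTo_lt hc h hb
  have h0 := unifProb_nonneg n fun π => ∃ c, j < c ∧ EntryAt π i c ∧ BeginsRun π c
  constructor <;> linarith

/-- The discrete form of g(y) = 1 - ∫_y^1 g, obtained by substituting `pInterior_succ`. -/
theorem one_sub_cdfAt_succ_bounds {n i j : ℕ} (hn : i ≤ n) :
    0 ≤ 1 - cdfAt (n + 1) (i + 1) j - (∑ c ∈ Finset.Ico j (n + 1), cdfAt n i c) / (n + 1) ∧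
      1 - cdfAt (n + 1) (i + 1) j - (∑ c ∈ Finset.Ico j (n + 1), cdfAt n i c) / (n + 1) ≤
        unifProb (n + 1) fun π => numInRunsUpTo π j < i + 1 := by
  have : (∑ c ∈ Finset.Ico j (n + 1), cdfAt n i c) / (n + 1) =
      ∑ c ∈ Finset.Ioc j (n + 1), pInterior (n + 1) (i + 1) c := by
    rw [Finset.sum_div]
    refine Finset.sum_bij (fun c _ => c + 1) ?_ ?_ ?_ ?_
    · intro c hc
      simp only [Finset.mem_Ico, Finset.mem_Ioc] at hc ⊢
      omega
    · intro a _ b _ h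
      omega
    · intro b hb
      simp only [Finset.mem_Ico, Finset.mem_Ioc] at hb ⊢
      exact ⟨b - 1, by omega, by omega⟩
    · intro c hc
      rw [Finset.mem_Ico] at hc
      rw [pInterior_succ n i c (by omega)]
  rw [this]
  exact one_sub_cdfAt_bounds (by omega) (by omega)

/-! ### Second moments of pattern counts -/

theorem exists_perm_comp_eq {ι α : Type*} [Finite α] (f g : ι ↪ α) :
    ∃ σ : Equiv.Perm α, ∀ a, σ (f a) = g a := by
  classical
  have := Fintype.ofFinite α
  let e : {x // x ∈ Set.range f} ≃ {x // x ∈ Set.range g} :=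
    (Equiv.ofInjective f f.injective).symm.trans (Equiv.ofInjective g g.injective)
  refine ⟨e.extendSubtype, fun a => ?_⟩
  rw [e.extendSubtype_apply_of_mem (f a) ⟨a, rfl⟩]
  simp [e]

/-- The restriction of a uniformly random permutation to given positions is a uniformly random
injection. -/
theorem unifProb_comp_mul_descFactorial {ι : Type*} [Fintype ι] {n : ℕ} (e : ι ↪ Fin n)
    (T : (ι → Fin n) → Prop) :
    unifProb n (fun π => T (π ∘ e)) * n.descFactorial (Fintype.card ι) =
      Nat.card {f : ι ↪ Fin n // T f} := by
  classical
  let r : Equiv.Perm (Fin n) → (ι ↪ Fin n) := fun π => e.trans π.toEmbedding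
  let N : (ι ↪ Fin n) → ℕ := fun f => (Finset.univ.filter fun π => r π = f).card
  -- Left multiplication by a permutation carrying one injection to another maps fibre onto fibre.
  have hN : ∀ f, N f = N e := by
    intro f
    obtain ⟨σ, hσ⟩ := exists_perm_comp_eq e f
    symm
    refine Finset.card_bij (fun π _ => σ * π) ?_ (fun _ _ _ _ h => mul_left_cancel h) ?_
    · intro π hπ
      simp only [Finset.mem_filter, Finset.mem_univ, true_and] at hπ ⊢
      ext1 a
      have := DFunLike.congr_fun hπ a
      simp only [r, Function.Embedding.trans_apply, Equiv.coe_toEmbedding] at this ⊢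
      rw [Equiv.Perm.mul_apply, this, hσ]
    · intro π hπ
      simp only [Finset.mem_filter, Finset.mem_univ, true_and] at hπ ⊢
      refine ⟨σ⁻¹ * π, ?_, by simp⟩
      ext1 a
      have := DFunLike.congr_fun hπ a
      simp only [r, Function.Embedding.trans_apply, Equiv.coe_toEmbedding] at this ⊢
      rw [Equiv.Perm.mul_apply, this, ← hσ]
      simp
  have htot : n.factorial = n.descFactorial (Fintype.card ι) * N e := by
    have h := Finset.card_eq_sum_card_fiberwise (f := r) (s := Finset.univ) (t := Finset.univ)
      (by simp)
    rw [Finset.card_univ, Fintype.card_perm, Fintype.card_fin] at h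
    rw [h, Finset.sum_congr rfl fun f _ => hN f]
    simp [Fintype.card_embedding_eq]
  have hcard : Nat.card {π : Equiv.Perm (Fin n) // T (π ∘ e)} =
      Nat.card {f : ι ↪ Fin n // T f} * N e := by
    rw [Nat.card_eq_fintype_card, Nat.card_eq_fintype_card, Fintype.card_subtype,
      Fintype.card_subtype]
    rw [Finset.card_eq_sum_card_fiberwise (f := r) (t := Finset.univ.filter fun f => T f)]
    · rw [Finset.sum_const_nat]
      intro f hf
      rw [← hN f]
      simp only [Finset.mem_filter, Finset.mem_univ, true_and] at hf
      simp only [N, Finset.filter_filter]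
      congr 1
      ext π
      simp only [Finset.mem_filter, Finset.mem_univ, true_and, and_iff_right_iff_imp]
      rintro rfl
      exact hf
    · intro π hπ
      exact Finset.mem_coe.2 (Finset.mem_filter.2 ⟨Finset.mem_univ _,
        (by simpa using hπ : T (π ∘ e))⟩)
  have hpos : (N e : ℝ) ≠ 0 := by
    intro h
    have : N e = 0 := by exact_mod_cast h
    rw [this] at htot
    exact n.factorial_ne_zero (by simpa using htot)
  have hpos2 : (n.descFactorial (Fintype.card ι) : ℝ) ≠ 0 := by
    intro h
    have : n.descFactorial (Fintype.card ι) = 0 := by exact_mod_cast h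
    rw [this] at htot
    exact n.factorial_ne_zero (by simpa using htot)
  unfold unifProb
  rw [hcard, Nat.card_eq_fintype_card (α := Equiv.Perm (Fin n)), Fintype.card_perm,
    Fintype.card_fin, htot]
  push_cast
  field_simp

/-- For k ≤ n/2 each factor satisfies (n-m-k)/(n-k) ≥ 1 - 2m/n; Bernoulli's inequality handles the
m-th power. -/
theorem descFactorial_sub_ge {n m : ℕ} (hn : 2 * m ≤ n) :
    (n.descFactorial m : ℝ) * (1 - 2 * m ^ 2 / n) ≤ (n - m).descFactorial m := by
  rcases Nat.eq_zero_or_pos n with rfl | hn0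
  · obtain rfl : m = 0 := by omega
    simp
  have hn0' : (0 : ℝ) < n := by exact_mod_cast hn0
  have hnm : 2 * (m : ℝ) ≤ n := by exact_mod_cast hn
  have hx : 0 ≤ 1 - 2 * (m : ℝ) / n := by
    rw [sub_nonneg, div_le_one hn0']
    exact hnm
  have h : ∀ k ≤ m, (n.descFactorial k : ℝ) * (1 - 2 * m / n) ^ k ≤ (n - m).descFactorial k := by
    intro k hk
    induction k with
    | zero => simp
    | succ k ih =>
      rw [Nat.descFactorial_succ, Nat.descFactorial_succ]
      push_cast [show k ≤ n by omega, show k ≤ n - m by omega, show m ≤ n by omega]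
      have hk' : 2 * (k : ℝ) ≤ n := by
        have : 2 * k ≤ n := by omega
        exact_mod_cast this
      have h1 : ((n : ℝ) - k) * (1 - 2 * m / n) ≤ n - m - k := by
        have : (m : ℝ) ≤ (n - k) * (2 * m / n) := by
          rw [mul_div_assoc', le_div_iff₀ hn0']
          nlinarith [(Nat.cast_nonneg m : (0 : ℝ) ≤ m)]
        linarith
      have hk2 : (0 : ℝ) ≤ n - k := by linarith [(Nat.cast_nonneg k : (0 : ℝ) ≤ k)]
      calc ((n : ℝ) - k) * n.descFactorial k * (1 - 2 * m / n) ^ (k + 1)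
          = (((n : ℝ) - k) * (1 - 2 * m / n)) * (n.descFactorial k * (1 - 2 * m / n) ^ k) := by
            ring
        _ ≤ _ := mul_le_mul h1 (ih (by omega)) (by positivity)
            ((mul_nonneg hk2 hx).trans h1)
  refine le_trans ?_ (h m le_rfl)
  gcongr
  have := one_add_mul_le_pow (a := -(2 * (m : ℝ) / n)) (by linarith) m
  calc (1 : ℝ) - 2 * m ^ 2 / n = 1 + m * -(2 * m / n) := by ring
    _ ≤ _ := this
    _ = _ := by ring

/-- Windows at disjoint places of a random permutation are almost uncorrelated. -/
theorem unifProb_and_le {m n : ℕ} (e e' : Fin m ↪ Fin n) (hd : ∀ a b, e a ≠ e' b)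
    (T : (Fin m → Fin n) → Prop) :
    unifProb n (fun π => T (π ∘ e) ∧ T (π ∘ e')) ≤
      unifProb n (fun π => T (π ∘ e)) ^ 2 + 2 * m ^ 2 / n := by
  set q := unifProb n (fun π => T (π ∘ e)) with hq
  have hle := unifProb_le_one n (fun π => T (π ∘ e) ∧ T (π ∘ e'))
  rcases lt_or_ge n (2 * m) with h | hn
  · refine hle.trans ?_
    rcases Nat.eq_zero_or_pos n with rfl | hn0
    · exact absurd (e ⟨0, by omega⟩).2 (by simp)
    · have : (1 : ℝ) ≤ 2 * m ^ 2 / n := by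
        rw [le_div_iff₀ (by exact_mod_cast hn0), one_mul]
        have : n ≤ 2 * m ^ 2 := by nlinarith
        exact_mod_cast this
      nlinarith [sq_nonneg q]
  · let e2 : Fin m ⊕ Fin m ↪ Fin n :=
      ⟨Sum.elim e e', e.injective.sumElim e'.injective hd⟩
    have h2 := unifProb_comp_mul_descFactorial e2
      (fun f => T (f ∘ Sum.inl) ∧ T (f ∘ Sum.inr))
    have h1 := unifProb_comp_mul_descFactorial e T
    -- Dropping the requirement that the two windows have disjoint values only enlarges the count;
    -- the price is the ratio bounded by `descFactorial_sub_ge`.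
    have hc : Nat.card {f : Fin m ⊕ Fin m ↪ Fin n // T (f ∘ Sum.inl) ∧ T (f ∘ Sum.inr)} ≤
        Nat.card {f : Fin m ↪ Fin n // T f} ^ 2 := by
      rw [sq, ← Nat.card_prod]
      refine Nat.card_le_card_of_injective (fun f =>
        (⟨Function.Embedding.inl.trans f.1, f.2.1⟩, ⟨Function.Embedding.inr.trans f.1, f.2.2⟩)) ?_
      rintro ⟨f, hf⟩ ⟨g, hg⟩ h
      simp only [Prod.mk.injEq] at h
      apply Subtype.ext
      ext1 a
      cases a with
      | inl a => exact DFunLike.congr_fun (congrArg Subtype.val h.1) a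
      | inr a => exact DFunLike.congr_fun (congrArg Subtype.val h.2) a
    have hcomp : ∀ π : Equiv.Perm (Fin n), ((π ∘ e2) ∘ Sum.inl = π ∘ e) ∧
        ((π ∘ e2) ∘ Sum.inr = π ∘ e') := fun π => ⟨rfl, rfl⟩
    simp only [hcomp, Fintype.card_sum, Fintype.card_fin] at h2 h1
    set q2 := unifProb n (fun π => T (π ∘ e) ∧ T (π ∘ e')) with hq2
    have hc' : q2 * n.descFactorial (m + m) ≤ (q * n.descFactorial m) ^ 2 := by
      rw [h1, h2]
      exact_mod_cast hc
    have hsplit := Nat.descFactorial_mul_descFactorial (n := n) (k := m) (m := m + m) (by omega)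
    rw [Nat.add_sub_cancel] at hsplit
    have hD : (0 : ℝ) < n.descFactorial m := by
      exact_mod_cast Nat.descFactorial_pos.2 (by omega)
    rw [← hsplit] at hc'
    push_cast at hc'
    have h3 : q2 * (n - m).descFactorial m ≤ q ^ 2 * n.descFactorial m := by
      refine le_of_mul_le_mul_right ?_ hD
      calc _ = q2 * (((n - m).descFactorial m : ℝ) * n.descFactorial m) := by ring
        _ ≤ _ := hc'
        _ = _ := by ring
    have hq20 : 0 ≤ q2 := unifProb_nonneg _ _
    have h4 : q2 * (1 - 2 * m ^ 2 / n) ≤ q ^ 2 := by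
      refine le_of_mul_le_mul_right ?_ hD
      calc _ = q2 * ((n.descFactorial m : ℝ) * (1 - 2 * m ^ 2 / n)) := by ring
        _ ≤ q2 * (n - m).descFactorial m := by
          gcongr
          exact descFactorial_sub_ge hn
        _ ≤ _ := h3
    have h5 : q2 * (2 * m ^ 2 / n) ≤ 2 * (m : ℝ) ^ 2 / n :=
      mul_le_of_le_one_left (by positivity) hle
    linarith

open Classical in
/-- The variance of the number of windows with a given pattern. -/
theorem permMean_sq_le {m n : ℕ} {P : Type*} [Fintype P] (e : P → (Fin m ↪ Fin n))
    (T : (Fin m → Fin n) → Prop) (q : ℝ) (hq : ∀ p, unifProb n (fun π => T (π ∘ e p)) = q)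
    (D : ℕ) (hD : ∀ p, (Finset.univ.filter fun p' => ¬ ∀ a b, e p a ≠ e p' b).card ≤ D) :
    permMean n (fun π => ((∑ p, if T (π ∘ e p) then (1 : ℝ) else 0) - Fintype.card P * q) ^ 2) ≤
      Fintype.card P * (D + Fintype.card P * (2 * m ^ 2 / n)) := by
  set N : ℝ := (Fintype.card P : ℝ) with hN
  have hS : permMean n (fun π => ∑ p, if T (π ∘ e p) then (1 : ℝ) else 0) = N * q := by
    rw [permMean_sum]
    simp only [← unifProb_eq_permMean, hq]
    simp [hN]
  have hSS : permMean n (fun π => (∑ p, if T (π ∘ e p) then (1 : ℝ) else 0) ^ 2) ≤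
      N * (D + N * (q ^ 2 + 2 * m ^ 2 / n)) := by
    have h1 : ∀ π : Equiv.Perm (Fin n), (∑ p, if T (π ∘ e p) then (1 : ℝ) else 0) ^ 2 =
        ∑ p, ∑ p', if T (π ∘ e p) ∧ T (π ∘ e p') then (1 : ℝ) else 0 := by
      intro π
      rw [sq, Finset.sum_mul_sum]
      refine Finset.sum_congr rfl fun p _ => Finset.sum_congr rfl fun p' _ => ?_
      rw [ite_and]
      split_ifs <;> simp
    simp only [h1]
    rw [permMean_sum]
    -- Overlapping pairs, at most `D` for each `p`, contribute at most 1 more than the bound for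
    -- disjoint pairs.
    have h2 : ∀ p, permMean n (fun π => ∑ p', if T (π ∘ e p) ∧ T (π ∘ e p') then (1 : ℝ) else 0) ≤
        D + N * (q ^ 2 + 2 * m ^ 2 / n) := by
      intro p
      rw [permMean_sum]
      simp only [← unifProb_eq_permMean]
      calc ∑ p', unifProb n (fun π => T (π ∘ e p) ∧ T (π ∘ e p'))
          ≤ ∑ p', ((if ¬ ∀ a b, e p a ≠ e p' b then (1 : ℝ) else 0) +
            (q ^ 2 + 2 * m ^ 2 / n)) := by
            refine Finset.sum_le_sum fun p' _ => ?_
            by_cases hd : ∀ a b, e p a ≠ e p' b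
            · have := unifProb_and_le (e p) (e p') hd T
              rw [hq] at this
              rw [if_neg (not_not.2 hd), zero_add]
              exact this
            · rw [if_pos hd]
              have := unifProb_le_one n (fun π => T (π ∘ e p) ∧ T (π ∘ e p'))
              have h0 : 0 ≤ q ^ 2 + 2 * (m : ℝ) ^ 2 / n := by positivity
              linarith
        _ ≤ _ := by
            rw [Finset.sum_add_distrib, Finset.sum_boole, Finset.sum_const, nsmul_eq_mul,
              Finset.card_univ]
            gcongr
            exact hD p
    calc _ ≤ ∑ _p : P, ((D : ℝ) + N * (q ^ 2 + 2 * m ^ 2 / n)) :=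
          Finset.sum_le_sum fun p _ => h2 p
      _ = _ := by rw [Finset.sum_const, nsmul_eq_mul, Finset.card_univ]
  have hexp : ∀ π : Equiv.Perm (Fin n),
      ((∑ p, if T (π ∘ e p) then (1 : ℝ) else 0) - N * q) ^ 2 =
      (∑ p, if T (π ∘ e p) then (1 : ℝ) else 0) ^ 2 +
        ((-2 * (N * q)) * (∑ p, if T (π ∘ e p) then (1 : ℝ) else 0) + (N * q) ^ 2) := by
    intro π
    ring
  simp only [hexp]
  rw [permMean_add, permMean_add, permMean_const_mul, hS, permMean_const]
  nlinarith

/-- Chebyshev's inequality for the lower tail. -/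
theorem unifProb_lt_le {n : ℕ} (S : Equiv.Perm (Fin n) → ℝ) (μ s δ V : ℝ) (hδ : 0 < δ)
    (hs : s + δ ≤ μ) (hV : permMean n (fun π => (S π - μ) ^ 2) ≤ V) :
    unifProb n (fun π => S π < s) ≤ V / δ ^ 2 := by
  classical
  rw [le_div_iff₀ (by positivity), mul_comm]
  refine le_trans ?_ hV
  rw [unifProb_eq_permMean, ← permMean_const_mul]
  refine permMean_mono fun π => ?_
  split_ifs with h
  · nlinarith
  · rw [mul_zero]
    positivity

/-! ### Counting entries of low runs through windows -/

theorem card_le_countP {α : Type*} (p : α → Bool) (l : List α) (s : Finset ℕ)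
    (hs : ∀ i ∈ s, ∃ x, l[i]? = some x ∧ p x) : s.card ≤ l.countP p := by
  induction l using List.reverseRecOn generalizing s with
  | nil =>
    have : s = ∅ := Finset.eq_empty_of_forall_notMem fun i hi => by simpa using hs i hi
    simp [this]
  | append_singleton l a ih =>
    have h := ih (s.erase l.length) fun i hi => by
      rw [Finset.mem_erase] at hi
      obtain ⟨x, hx, hp⟩ := hs i hi.2
      refine ⟨x, ?_, hp⟩
      rw [List.getElem?_append] at hx
      split_ifs at hx with hlt
      · exact hx
      · rw [List.getElem?_singleton] at hx
        split_ifs at hx with h0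
        omega
    rw [List.countP_append]
    by_cases hl : l.length ∈ s
    · obtain ⟨x, hx, hp⟩ := hs _ hl
      have hxa : a = x := by simpa using hx
      rw [Finset.card_erase_of_mem hl] at h
      simp only [List.countP_singleton, hxa, hp, if_true]
      omega
    · rw [Finset.erase_eq_of_notMem hl] at h
      omega

theorem isChain_runTagsFrom (h c : ℕ) (l : List ℕ) :
    (toLex (h, c) :: runTagsFrom h c l).IsChain
      fun t t' => (ofLex t).2 < (ofLex t').2 → (ofLex t').1 = (ofLex t).1 := by
  induction l generalizing h c with
  | nil => simp [runTagsFrom]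
  | cons d l ih =>
    unfold runTagsFrom
    split_ifs with hcd
    · exact List.isChain_cons_cons.2 ⟨fun _ => rfl, ih h d⟩
    · exact List.isChain_cons_cons.2 ⟨fun h => absurd h hcd, ih d d⟩

theorem isChain_runTags (l : List ℕ) :
    (runTags l).IsChain fun t t' => (ofLex t).2 < (ofLex t').2 → (ofLex t').1 = (ofLex t).1 := by
  cases l with
  | nil => simp [runTags]
  | cons a l => exact isChain_runTagsFrom a a l

theorem fst_le_snd_of_mem_runTags {l : List ℕ} {t : ℕ ×ₗ ℕ} (ht : t ∈ runTags l) :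
    (ofLex t).1 ≤ (ofLex t).2 := by
  have H : ∀ (l : List ℕ) (h c : ℕ), h ≤ c → t ∈ runTagsFrom h c l →
      (ofLex t).1 ≤ (ofLex t).2 := by
    intro l
    induction l with
    | nil => simp [runTagsFrom]
    | cons d l ih =>
      intro h c hhc ht
      unfold runTagsFrom at ht
      split_ifs at ht with hcd
      · rcases List.mem_cons.1 ht with rfl | ht
        · exact hhc.trans hcd.le
        · exact ih h d (hhc.trans hcd.le) ht
      · rcases List.mem_cons.1 ht with rfl | ht
        · exact le_rfl
        · exact ih d d le_rfl ht
  cases l with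
  | nil => simp [runTags] at ht
  | cons a l =>
    rcases List.mem_cons.1 ht with rfl | ht
    · exact le_rfl
    · exact H l a a le_rfl ht

/-- Extension by zero of a finite sequence of numbers. -/
def finExtend {m n : ℕ} (f : Fin m → Fin n) (a : ℕ) : ℕ :=
  if h : a < m then f ⟨a, h⟩ else 0

/-- The sequence `v` has a value below `j` at `s` and then increases for `k` steps through values
that are at least `j`. -/
def RisesFrom (j : ℕ) (v : ℕ → ℕ) (s k : ℕ) : Prop :=
  v s < j ∧ ∀ i < k, j ≤ v (s + 1 + i) ∧ v (s + i) < v (s + 1 + i)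

theorem RisesFrom.congr {j s k s' : ℕ} {v w : ℕ → ℕ} (h : RisesFrom j v s k)
    (hvw : ∀ i ≤ k, v (s + i) = w (s' + i)) : RisesFrom j w s' k := by
  refine ⟨(hvw 0 (by omega)).symm.trans_lt h.1, fun i hi => ?_⟩
  have h2 := hvw (i + 1) (by omega)
  rw [show s' + 1 + i = s' + (i + 1) by ring, ← h2, ← hvw i (by omega),
    show s + (i + 1) = s + 1 + i by ring]
  exact h.2 i hi

/-- The start of the rise is the last value below j up to K. The events for different k are
therefore disjoint and their probabilities add. -/
theorem RisesFrom.length_unique {j K k k' : ℕ} {v : ℕ → ℕ} (hk : k ≤ K) (hk' : k' ≤ K)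
    (h : RisesFrom j v (K - k) k) (h' : RisesFrom j v (K - k') k') : k = k' := by
  have H : ∀ {a b : ℕ}, a ≤ K → b ≤ K → RisesFrom j v (K - a) a → RisesFrom j v (K - b) b →
      ¬ a < b := by
    intro a b ha hb h1 h2 hab
    have := (h2.2 (b - a - 1) (by omega)).1
    rw [show K - b + 1 + (b - a - 1) = K - a by omega] at this
    exact absurd h1.1 (not_lt.2 this)
  exact le_antisymm (not_lt.1 (H hk' hk h' h)) (not_lt.1 (H hk hk' h h'))

/-- At s the run's beginning is at most the entry, and ascents preserve the beginning. Values in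
`Fin n` are one less than entries, so a value below j is an entry at most j. -/
theorem runTags_getElem?_of_risesFrom {n : ℕ} (π : Equiv.Perm (Fin n)) {j s k : ℕ}
    (hn : s + k < n) (h : RisesFrom j (finExtend π) s k) :
    ∃ t, (runTags (oneLine π))[s + k]? = some t ∧ (ofLex t).1 ≤ j := by
  have hlen : (runTags (oneLine π)).length = n := by rw [length_runTags, length_oneLine]
  have hsnd : ∀ a, (ha : a < n) → (ofLex ((runTags (oneLine π))[a]'(by omega))).2 =
      finExtend π a + 1 := by
    intro a ha
    have h1 : ((runTags (oneLine π)).map fun t => (ofLex t).2)[a]? = (oneLine π)[a]? := by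
      rw [map_snd_runTags]
    rw [List.getElem?_map, List.getElem?_eq_getElem (by omega),
      List.getElem?_eq_getElem (by rw [length_oneLine]; omega)] at h1
    simpa [oneLine, finExtend, ha] using h1
  refine ⟨(runTags (oneLine π))[s + k], List.getElem?_eq_getElem _, ?_⟩
  induction k with
  | zero =>
    have h1 := fst_le_snd_of_mem_runTags (List.getElem_mem (l := runTags (oneLine π))
      (show s < _ by omega))
    rw [hsnd s (by omega)] at h1
    have := h.1
    simp only [add_zero]
    omega
  | succ k ih =>
    have ih := ih (by omega) ⟨h.1, fun i hi => h.2 i (by omega)⟩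
    have h2 := List.isChain_iff_getElem.1 (isChain_runTags (oneLine π)) (s + k) (by omega)
    rw [hsnd (s + k) (by omega), hsnd (s + k + 1) (by omega)] at h2
    have h3 := (h.2 k (by omega)).2
    rw [show s + 1 + k = s + k + 1 by ring] at h3
    have h4 := h2 (by omega)
    exact h4.le.trans (ih hsnd)

/-- The last entry of the word `f` lies in a run that has a value below `j`, at most `K` steps
back. -/
def EndsInLowRun {n : ℕ} (j K : ℕ) (f : Fin (K + 1) → Fin n) : Prop :=
  ∃ k ≤ K, RisesFrom j (finExtend f) (K - k) k

/-- The window of length `K + 1` that begins at position `p`. -/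
def window (n K : ℕ) (p : Fin (n - K)) : Fin (K + 1) ↪ Fin n where
  toFun a := ⟨p + a, by omega⟩
  inj' a b h := by
    simp only [Fin.mk.injEq] at h
    exact Fin.ext (by omega)

theorem finExtend_comp_window {n K : ℕ} (π : Equiv.Perm (Fin n)) (p : Fin (n - K)) {a : ℕ}
    (ha : a ≤ K) : finExtend (π ∘ window n K p) a = finExtend π (p + a) := by
  have h1 : a < K + 1 := by omega
  have h2 : p + a < n := by omega
  simp only [finExtend, h1, h2, dif_pos]
  rfl

open Classical in
theorem sum_endsInLowRun_le {n : ℕ} (π : Equiv.Perm (Fin n)) (j K : ℕ) :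
    (∑ p, if EndsInLowRun j K (π ∘ window n K p) then (1 : ℝ) else 0) ≤ numInRunsUpTo π j := by
  rw [Finset.sum_boole, Nat.cast_le]
  have hinj : Function.Injective fun p : Fin (n - K) => (p : ℕ) + K := fun a b h => by
    simp only [Nat.add_right_cancel_iff] at h
    exact Fin.ext h
  rw [← Finset.card_image_of_injective _ hinj]
  apply card_le_countP
  intro i hi
  simp only [Finset.mem_image, Finset.mem_filter, Finset.mem_univ, true_and] at hi
  obtain ⟨p, ⟨k, hk, h⟩, rfl⟩ := hi
  have h' : RisesFrom j (finExtend π) (p + (K - k)) k := h.congr fun i hi => by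
    rw [finExtend_comp_window π p (by omega), add_assoc]
  have := runTags_getElem?_of_risesFrom π (by omega) h'
  rw [show (p : ℕ) + (K - k) + k = p + K by omega] at this
  simpa using this

theorem card_orderEmbedding_fin (k m : ℕ) : Nat.card (Fin k ↪o Fin m) = m.choose k := by
  rw [Nat.card_congr Set.powersetCard.ofFinEmbEquiv, Set.powersetCard.card]
  simp

/-- A start below j and a k-subset of the n - j remaining values, listed increasingly, can be chosen
independently. -/
theorem le_card_risesFrom {n j : ℕ} (hj : j ≤ n) (k : ℕ) :
    j * (n - j).choose k ≤
      Nat.card {f : Fin (k + 1) ↪ Fin n // RisesFrom j (finExtend f) 0 k} := by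
  have : j * (n - j).choose k = Nat.card (Fin j × (Fin k ↪o Fin (n - j))) := by
    rw [Nat.card_prod, card_orderEmbedding_fin, Nat.card_fin]
  rw [this]
  let F : Fin j × (Fin k ↪o Fin (n - j)) → Fin (k + 1) → Fin n := fun x =>
    Fin.cons ⟨x.1, by omega⟩ fun i => ⟨j + x.2 i, by omega⟩
  have hF : ∀ x, Function.Injective (F x) := by
    rintro ⟨a, g⟩
    rw [Fin.cons_injective_iff]
    constructor
    · rintro ⟨i, hi⟩
      simp only [Fin.mk.injEq] at hi
      omega
    · intro i i' h
      simp only [Fin.mk.injEq, Nat.add_left_cancel_iff] at h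
      exact g.injective (Fin.ext h)
  have h0 : ∀ x, finExtend (F x) 0 = x.1 := fun x => by simp [finExtend, F]
  have hs : ∀ x i, (hi : i < k) → finExtend (F x) (i + 1) = j + x.2 ⟨i, hi⟩ := fun x i hi => by
    rw [finExtend, dif_pos (by omega)]
    rfl
  refine Nat.card_le_card_of_injective (fun x => ⟨⟨F x, hF x⟩, ?_, ?_⟩) ?_
  · exact (h0 x).trans_lt x.1.2
  · intro i hi
    change j ≤ finExtend (F x) (0 + 1 + i) ∧ finExtend (F x) (0 + i) < finExtend (F x) (0 + 1 + i)
    rw [zero_add, zero_add, add_comm 1 i, hs x i hi]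
    refine ⟨by omega, ?_⟩
    cases i with
    | zero =>
      rw [h0]
      omega
    | succ i =>
      rw [hs x i (by omega)]
      have : x.2 ⟨i, by omega⟩ < x.2 ⟨i + 1, hi⟩ := x.2.strictMono (by simp [Fin.lt_def])
      simp
  · rintro ⟨a, g⟩ ⟨a', g'⟩ h
    replace h : F (a, g) = F (a', g') := congrArg (fun f => (f.1 : Fin (k + 1) → Fin n)) h
    have e0 : (a : ℕ) = a' := by rw [← h0 (a, g), h, h0]
    have e1 : g = g' := by
      ext i
      have := hs (a, g) i i.2
      rw [h, hs _ i i.2] at this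
      simpa using this.symm
    rw [e1, Fin.ext e0]

theorem le_unifProb_endsInLowRun {n j K : ℕ} (hj : j ≤ n) (p : Fin (n - K)) :
    ∑ k ∈ Finset.range (K + 1), (j * (n - j).choose k : ℝ) / n.descFactorial (k + 1) ≤
      unifProb n fun π => EndsInLowRun j K (π ∘ window n K p) := by
  classical
  have hpart : (unifProb n fun π => EndsInLowRun j K (π ∘ window n K p)) =
      ∑ k ∈ Finset.range (K + 1),
        unifProb n fun π => RisesFrom j (finExtend (π ∘ window n K p)) (K - k) k := by
    simp only [unifProb_eq_permMean]
    rw [← permMean_sum]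
    congr 1
    funext π
    by_cases h : EndsInLowRun j K (π ∘ window n K p)
    · rw [if_pos h]
      obtain ⟨k, hk, hr⟩ := h
      rw [Finset.sum_eq_single k, if_pos hr]
      · intro k' hk' hne
        rw [if_neg]
        intro hr'
        exact hne (hr'.length_unique (by simpa [Nat.lt_succ_iff] using hk') hk hr)
      · intro h
        simp at h
        omega
    · rw [if_neg h, Finset.sum_eq_zero]
      intro k hk
      rw [if_neg]
      exact fun hr => h ⟨k, by simpa [Nat.lt_succ_iff] using hk, hr⟩
  rw [hpart]
  refine Finset.sum_le_sum fun k hk => ?_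
  have hk : k ≤ K := by simpa [Nat.lt_succ_iff] using hk
  have hD : (0 : ℝ) < n.descFactorial (k + 1) := by
    exact_mod_cast Nat.descFactorial_pos.2 (by have := p.isLt; omega)
  rw [div_le_iff₀ hD]
  let e : Fin (k + 1) ↪ Fin n :=
    ⟨fun a => ⟨p + (K - k) + a, by omega⟩, fun a b h => by
      simp only [Fin.mk.injEq] at h
      exact Fin.ext (by omega)⟩
  have h1 := unifProb_comp_mul_descFactorial e fun f => RisesFrom j (finExtend f) 0 k
  rw [Fintype.card_fin] at h1
  have h2 : (fun π : Equiv.Perm (Fin n) =>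
      RisesFrom j (finExtend (π ∘ window n K p)) (K - k) k) =
      fun π : Equiv.Perm (Fin n) => RisesFrom j (finExtend (π ∘ e)) 0 k := by
    funext π
    have hv : ∀ i ≤ k, finExtend (π ∘ window n K p) (K - k + i) = finExtend (π ∘ e) (0 + i) := by
      intro i hi
      have h3 : i < k + 1 := by omega
      have h4 : (p : ℕ) + (K - k) + i < n := by omega
      rw [finExtend_comp_window π p (by omega), ← add_assoc]
      simp only [finExtend, zero_add, h3, h4, dif_pos]
      rfl
    exact propext ⟨fun h => h.congr hv, fun h => h.congr fun i hi => (hv i hi).symm⟩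
  rw [h2, h1]
  exact_mod_cast le_card_risesFrom hj k

theorem card_overlapping_windows_le {n K : ℕ} (p : Fin (n - K)) :
    (Finset.univ.filter fun p' => ¬ ∀ a b, window n K p a ≠ window n K p' b).card ≤
      2 * K + 1 := by
  rw [← Finset.card_image_of_injective _ Fin.val_injective]
  refine (Finset.card_le_card (t := Finset.Icc ((p : ℕ) - K) (p + K)) ?_).trans ?_
  · intro x hx
    simp only [Finset.mem_image, Finset.mem_filter, Finset.mem_univ, true_and, not_forall,
      not_not] at hx
    obtain ⟨p', ⟨a, b, hab⟩, rfl⟩ := hx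
    replace hab : (p : ℕ) + a = p' + b := congrArg Fin.val hab
    rw [Finset.mem_Icc]
    omega
  · rw [Nat.card_Icc]
    omega

/-- The n - K windows have a common success probability q, and the mean (n - K)q exceeds an by at
least δn. The variance is O(n), since a window meets at most 2K + 1 windows, so Chebyshev yields
O(1/n). -/
theorem unifProb_numInRunsUpTo_lt_le {n j K : ℕ} (hj : j ≤ n) (hK : K < n) {a δ : ℝ}
    (hδ : 0 < δ)
    (h : (a + δ) * n ≤ (n - K) *
      ∑ k ∈ Finset.range (K + 1), (j * (n - j).choose k : ℝ) / n.descFactorial (k + 1)) :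
    unifProb n (fun π => (numInRunsUpTo π j : ℝ) < a * n) ≤
      ((2 * K + 1) + 2 * (K + 1) ^ 2) / δ ^ 2 / n := by
  classical
  have hn : (0 : ℝ) < n := by exact_mod_cast (show 0 < n by omega)
  let p₀ : Fin (n - K) := ⟨0, by omega⟩
  set q := unifProb n fun π => EndsInLowRun j K (π ∘ window n K p₀) with hq
  have hqp : ∀ p, unifProb n (fun π => EndsInLowRun j K (π ∘ window n K p)) = q := by
    intro p
    have hD : (n.descFactorial (K + 1) : ℝ) ≠ 0 := by
      exact_mod_cast (Nat.descFactorial_pos.2 (by omega)).ne'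
    apply mul_right_cancel₀ hD
    have h1 := unifProb_comp_mul_descFactorial (window n K p) (EndsInLowRun j K)
    have h2 := unifProb_comp_mul_descFactorial (window n K p₀) (EndsInLowRun j K)
    rw [Fintype.card_fin] at h1 h2
    rw [hq, h1, h2]
  have hvar := permMean_sq_le (window n K) (EndsInLowRun j K) q hqp (2 * K + 1)
    card_overlapping_windows_le
  rw [Fintype.card_fin] at hvar
  have hcast : ((n - K : ℕ) : ℝ) = n - K := Nat.cast_sub hK.le
  have hle := unifProb_lt_le _ _ (a * n) (δ * n) _ (by positivity) (by
    calc a * n + δ * n = (a + δ) * n := by ring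
      _ ≤ _ := h
      _ ≤ ((n - K : ℕ) : ℝ) * q := by
        rw [hcast]
        have : (0 : ℝ) ≤ n - K := by rw [← hcast]; positivity
        gcongr
        exact le_unifProb_endsInLowRun hj p₀) hvar
  refine (unifProb_mono fun π hπ => ?_).trans (hle.trans ?_)
  · exact (sum_endsInLowRun_le π j K).trans_lt hπ
  · have h1 : ((n - K : ℕ) : ℝ) ≤ n := by
      exact_mod_cast Nat.sub_le n K
    calc _ ≤ (n : ℝ) * ((2 * K + 1 : ℕ) + n * (2 * (K + 1 : ℕ) ^ 2 / n)) / (δ * n) ^ 2 := by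
          gcongr
      _ = _ := by
          push_cast
          field_simp
-- The limiting share of entries in low runs
open Filter Topology

theorem tendsto_descFactorial_div_pow {r : ℕ → ℕ} {ρ : ℝ}
    (hr : Tendsto (fun n => (r n : ℝ) / n) atTop (𝓝 ρ)) (k : ℕ) :
    Tendsto (fun n => ((r n).descFactorial k : ℝ) / (n : ℝ) ^ k) atTop (𝓝 (ρ ^ k)) := by
  induction k with
  | zero => simp
  | succ k ih =>
    have h1 : Tendsto (fun n => ((r n - k : ℕ) : ℝ) / n) atTop (𝓝 ρ) := by
      have h2 : Tendsto (fun n : ℕ => (r n : ℝ) / n - (k : ℝ) / n) atTop (𝓝 ρ) := by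
        simpa using hr.sub (tendsto_const_div_atTop_nhds_zero_nat (k : ℝ))
      refine tendsto_of_tendsto_of_tendsto_of_le_of_le h2 hr (fun n => ?_) fun n => ?_
      · simp only
        rw [← sub_div]
        gcongr
        rw [sub_le_iff_le_add]
        exact_mod_cast (by omega : r n ≤ (r n - k) + k)
      · simp only
        gcongr
        omega
    rw [pow_succ']
    refine (h1.mul ih).congr fun n => ?_
    rw [Nat.descFactorial_succ, pow_succ']
    push_cast
    rw [div_mul_div_comm]

theorem tendsto_sum_choose {r : ℕ → ℕ} {b : ℝ} (hrn : ∀ n, r n ≤ n)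
    (hr : Tendsto (fun n => (r n : ℝ) / n) atTop (𝓝 b)) (K : ℕ) :
    Tendsto (fun n => ∑ k ∈ Finset.range (K + 1),
      (r n * (n - r n).choose k : ℝ) / n.descFactorial (k + 1)) atTop
      (𝓝 (∑ k ∈ Finset.range (K + 1), b * ((1 - b) ^ k / k.factorial))) := by
  refine tendsto_finsetSum _ fun k _ => ?_
  have h1 : Tendsto (fun n => ((n - r n : ℕ) : ℝ) / n) atTop (𝓝 (1 - b)) := by
    refine (hr.const_sub 1).congr' ?_
    filter_upwards [eventually_gt_atTop 0] with n hn
    rw [Nat.cast_sub (hrn n)]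
    field_simp
  have h2 : Tendsto (fun n : ℕ => (n : ℝ) / n) atTop (𝓝 1) := by
    refine tendsto_const_nhds.congr' ?_
    filter_upwards [eventually_gt_atTop 0] with n hn
    field_simp
  have h3 := tendsto_descFactorial_div_pow h1 k
  have h4 := tendsto_descFactorial_div_pow (r := fun n => n) h2 (k + 1)
  rw [one_pow] at h4
  have h5 := ((hr.mul h3).div_const (k.factorial : ℝ)).div h4 one_ne_zero
  rw [div_one, mul_div_assoc] at h5
  refine h5.congr' ?_
  filter_upwards [eventually_gt_atTop 0] with n hn
  have hn' : (n : ℝ) ≠ 0 := by positivity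
  have hf : (k.factorial : ℝ) ≠ 0 := by positivity
  simp only [Pi.div_apply, Nat.descFactorial_eq_factorial_mul_choose (n - r n) k,
    Nat.cast_mul]
  rcases eq_or_ne (n.descFactorial (k + 1) : ℝ) 0 with h0 | h0
  · simp only [h0, zero_div, div_zero]
  · field_simp
    ring

/-- With `i ≤ a n`, `b n ≤ j` and `a < b e^{1-b}`, the runs with beginnings up to `j` have at
least `i` entries, except with probability `O(1/n)`. -/
theorem exists_unifProb_numInRunsUpTo_le {a b : ℝ} (hb : 0 < b) (hb1 : b < 1)
    (hab : a < b * Real.exp (1 - b)) :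
    ∃ C : ℝ, 0 ≤ C ∧ ∀ n i j : ℕ, 1 ≤ n → (i : ℝ) ≤ a * n → b * n ≤ j →
      unifProb n (fun π => numInRunsUpTo π j < i) ≤ C / n := by
  have hsum : Tendsto (fun K => ∑ k ∈ Finset.range (K + 1), b * ((1 - b) ^ k / k.factorial))
      atTop (𝓝 (b * Real.exp (1 - b))) := by
    have h := (NormedSpace.expSeries_div_hasSum_exp (1 - b)).mul_left b
    rw [← Real.exp_eq_exp_ℝ] at h
    exact h.tendsto_sum_nat.comp (tendsto_add_atTop_nat 1)
  -- A fixed window length suffices: the truncated series for b e^{1-b} already exceeds a.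
  obtain ⟨K, hK⟩ := (hsum.eventually (lt_mem_nhds hab)).exists
  set c := ∑ k ∈ Finset.range (K + 1), b * ((1 - b) ^ k / k.factorial) with hc
  obtain ⟨δ, hδ, hδc⟩ : ∃ δ : ℝ, 0 < δ ∧ a + δ < c := ⟨(c - a) / 2, by linarith, by linarith⟩
  have hr : Tendsto (fun n : ℕ => (⌈b * n⌉₊ : ℝ) / n) atTop (𝓝 b) :=
    (tendsto_nat_ceil_mul_div_atTop hb.le).comp tendsto_natCast_atTop_atTop
  have hrn : ∀ n : ℕ, ⌈b * n⌉₊ ≤ n := fun n => by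
    rw [Nat.ceil_le]
    exact mul_le_of_le_one_left (by positivity) hb1.le
  have hlow := tendsto_sum_choose hrn hr K
  have hN : Tendsto (fun n : ℕ => 1 - (K : ℝ) / n) atTop (𝓝 1) := by
    simpa using (tendsto_const_div_atTop_nhds_zero_nat (K : ℝ)).const_sub 1
  have hprod := hN.mul hlow
  rw [one_mul, ← hc] at hprod
  obtain ⟨N, hN⟩ := eventually_atTop.1 ((hprod.eventually (lt_mem_nhds hδc)).and
    (eventually_gt_atTop K))
  -- The entry `N` of the maximum covers n < N, where the bound is at least 1.
  refine ⟨max (((2 * K + 1) + 2 * (K + 1) ^ 2) / δ ^ 2) N, by positivity, ?_⟩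
  intro n i j hn hi hj
  have hn0 : (0 : ℝ) < n := by exact_mod_cast hn
  rcases lt_or_ge n N with hlt | hge
  · refine (unifProb_le_one _ _).trans ?_
    rw [le_div_iff₀ hn0, one_mul]
    exact le_max_of_le_right (by exact_mod_cast hlt.le)
  · obtain ⟨h1, h2⟩ := hN n hge
    have h3 := unifProb_numInRunsUpTo_lt_le (a := a) (hrn n) h2 hδ (by
      calc (a + δ) * n ≤ _ := mul_le_mul_of_nonneg_right h1.le hn0.le
        _ = _ := by
          rw [mul_right_comm]
          congr 1
          field_simp)
    refine (unifProb_mono fun π hπ => ?_).trans (h3.trans ?_)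
    · have h4 : numInRunsUpTo π ⌈b * n⌉₊ ≤ numInRunsUpTo π j := by
        apply List.countP_mono_left
        intro t _ ht
        simp only [decide_eq_true_eq] at ht ⊢
        exact ht.trans (Nat.ceil_le.2 hj)
      calc (numInRunsUpTo π ⌈b * n⌉₊ : ℝ) < i := by exact_mod_cast h4.trans_lt hπ
        _ ≤ a * n := hi
    · gcongr
      exact le_max_left _ _

/-! ### Comparing the recursion with the exponential -/

theorem abs_exp_sub_exp_le {u v : ℝ} (hu : u ≤ 0) (hv : v ≤ 0) :
    |Real.exp u - Real.exp v| ≤ |u - v| := by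
  have H : ∀ {u v : ℝ}, u ≤ 0 → Real.exp u - Real.exp v ≤ |u - v| := by
    intro u v hu
    have h1 := Real.add_one_le_exp (v - u)
    have h2 : Real.exp v = Real.exp u * Real.exp (v - u) := by rw [← Real.exp_add]; congr 1; ring
    have h3 : Real.exp u ≤ 1 := Real.exp_le_one_iff.2 hu
    have h4 : Real.exp u - Real.exp v ≤ Real.exp u * (u - v) := by
      rw [h2]
      nlinarith [Real.exp_pos u]
    exact h4.trans ((mul_le_mul_of_nonneg_left (le_abs_self _) (Real.exp_pos u).le).trans
      (mul_le_of_le_one_left (abs_nonneg _) h3))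
  rw [abs_le]
  have := H (v := u) hv
  rw [abs_sub_comm] at this
  exact ⟨by linarith, H hu⟩

/-- With mesh h = 1/(n+1), linearizing one step costs h², and replacing c/(n+1) by c/n inside the
derivative costs another h². -/
theorem abs_exp_step_sub_le {n c : ℕ} (hn : 1 ≤ n) (hc : c ≤ n) :
    |(Real.exp ((c + 1 : ℕ) / (n + 1) - 1) - Real.exp (c / (n + 1) - 1)) -
      Real.exp (c / n - 1) / (n + 1)| ≤ 2 / ((n : ℝ) + 1) ^ 2 := by
  have hn0 : (0 : ℝ) < n := by exact_mod_cast hn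
  have hcn : (c : ℝ) ≤ n := by exact_mod_cast hc
  set h : ℝ := 1 / ((n : ℝ) + 1) with hh
  have hpos : 0 < h := by positivity
  have hle : h ≤ 1 := by
    rw [hh, div_le_one (by positivity)]
    linarith
  have hu : (c : ℝ) / (n + 1) - 1 ≤ 0 := by
    rw [sub_nonpos, div_le_one (by positivity)]
    linarith
  have hv : (c : ℝ) / n - 1 ≤ 0 := by
    rw [sub_nonpos, div_le_one (by positivity)]
    linarith
  have e1 : Real.exp ((c + 1 : ℕ) / (n + 1) - 1) =
      Real.exp (c / (n + 1) - 1) * Real.exp h := by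
    rw [← Real.exp_add]
    congr 1
    rw [hh]
    push_cast
    ring
  have b1 := Real.abs_exp_sub_one_sub_id_le (x := h) (by rwa [abs_of_pos hpos])
  have b2 := abs_exp_sub_exp_le hu hv
  have b3 : |(c : ℝ) / (n + 1) - 1 - (c / n - 1)| ≤ h := by
    have : (c : ℝ) / (n + 1) - 1 - (c / n - 1) = -((c / n) * h) := by
      rw [hh]
      field_simp
      ring
    rw [this, abs_neg, abs_of_nonneg (by positivity)]
    exact mul_le_of_le_one_left hpos.le (by linarith)
  have g1 : Real.exp ((c : ℝ) / (n + 1) - 1) ≤ 1 := Real.exp_le_one_iff.2 hu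
  set g := Real.exp ((c : ℝ) / (n + 1) - 1) with hg
  have g0 : 0 ≤ g := (Real.exp_pos _).le
  rw [e1]
  calc |g * Real.exp h - g - Real.exp (c / n - 1) / (n + 1)|
      = |g * (Real.exp h - 1 - h) + (g - Real.exp (c / n - 1)) * h| := by
        congr 1
        rw [hh]
        ring
    _ ≤ |g * (Real.exp h - 1 - h)| + |(g - Real.exp (c / n - 1)) * h| := abs_add_le _ _
    _ = g * |Real.exp h - 1 - h| + |g - Real.exp (c / n - 1)| * h := by
        rw [abs_mul, abs_mul, abs_of_nonneg g0, abs_of_pos hpos]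
    _ ≤ 1 * h ^ 2 + h * h := by
        gcongr
        exact b2.trans b3
    _ = 2 * h ^ 2 := by ring
    _ = 2 / ((n : ℝ) + 1) ^ 2 := by
        rw [hh]
        field_simp

theorem cdfAt_nonneg (n i j : ℕ) : 0 ≤ cdfAt n i j := unifProb_nonneg _ _

theorem cdfAt_le_one (n i j : ℕ) : cdfAt n i j ≤ 1 := unifProb_le_one _ _

theorem abs_cdfAt_sub_exp_le_one {n i j : ℕ} (hj : j ≤ n) :
    |cdfAt n i j - Real.exp (j / n - 1)| ≤ 1 := by
  have h0 := cdfAt_nonneg n i j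
  have h1 := cdfAt_le_one n i j
  have h2 := Real.exp_pos ((j : ℝ) / n - 1)
  have h3 : Real.exp ((j : ℝ) / n - 1) ≤ 1 := by
    rw [Real.exp_le_one_iff, sub_nonpos]
    exact div_le_one_of_le₀ (by exact_mod_cast hj) (by positivity)
  rw [abs_le]
  constructor <;> linarith

theorem abs_cdfAt_succ_sub_exp_le {n i j : ℕ} {B ε : ℝ} (hn : 1 ≤ n) (hi : i ≤ n)
    (hj : j ≤ n + 1)
    (hε : ∀ c, j ≤ c → c ≤ n → |cdfAt n i c - Real.exp (c / n - 1)| ≤ ε)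
    (hB : unifProb (n + 1) (fun π => numInRunsUpTo π j < i + 1) ≤ B) :
    |cdfAt (n + 1) (i + 1) j - Real.exp (j / (n + 1 : ℕ) - 1)| ≤
      (1 - j / (n + 1)) * (ε + 2 / (n + 1)) + B := by
  obtain ⟨h0, h1⟩ := one_sub_cdfAt_succ_bounds (j := j) hi
  have hn0 : (0 : ℝ) < n + 1 := by positivity
  -- The telescoping sum expresses that the exponential solves the integral equation.
  have htel : ∑ c ∈ Finset.Ico j (n + 1),
      (Real.exp ((c + 1 : ℕ) / (n + 1) - 1) - Real.exp (c / (n + 1) - 1)) =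
      1 - Real.exp (j / (n + 1) - 1) := by
    rw [Finset.sum_Ico_sub (fun c : ℕ => Real.exp ((c : ℝ) / (n + 1) - 1)) hj]
    push_cast
    rw [div_self hn0.ne', sub_self, Real.exp_zero]
  have hsum : |∑ c ∈ Finset.Ico j (n + 1),
      ((Real.exp ((c + 1 : ℕ) / (n + 1) - 1) - Real.exp (c / (n + 1) - 1)) -
        cdfAt n i c / (n + 1))| ≤ (1 - j / (n + 1)) * (ε + 2 / (n + 1)) := by
    calc _ ≤ ∑ c ∈ Finset.Ico j (n + 1), (ε + 2 / ((n : ℝ) + 1)) / (n + 1) := by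
          refine (Finset.abs_sum_le_sum_abs _ _).trans (Finset.sum_le_sum fun c hc => ?_)
          rw [Finset.mem_Ico] at hc
          have b1 := abs_exp_step_sub_le hn (show c ≤ n by omega)
          have b2 := hε c hc.1 (by omega)
          have b3 : |Real.exp ((c : ℝ) / n - 1) / (n + 1) - cdfAt n i c / (n + 1)| ≤
              ε / (n + 1) := by
            rw [← sub_div, abs_div, abs_of_pos hn0, abs_sub_comm]
            gcongr
          refine (abs_sub_le _ (Real.exp ((c : ℝ) / n - 1) / (n + 1)) _).trans
            ((add_le_add b1 b3).trans (le_of_eq ?_))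
          field_simp
          ring
      _ = _ := by
          rw [Finset.sum_const, Nat.card_Ico, nsmul_eq_mul, Nat.cast_sub hj]
          push_cast
          field_simp
  rw [Finset.sum_sub_distrib, htel, ← Finset.sum_div] at hsum
  push_cast
  rw [abs_le] at hsum ⊢
  constructor <;> linarith

theorem exists_abs_cdfAt_sub_exp_le {a b : ℝ} (hb : 0 < b) (hb1 : b < 1)
    (hab : a < b * Real.exp (1 - b)) :
    ∃ M : ℝ, 0 ≤ M ∧ ∀ i n j : ℕ, (i : ℝ) ≤ a * n → b * n ≤ j → j ≤ n →
      |cdfAt n i j - Real.exp (j / n - 1)| ≤ M / (i + 1) := by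
  obtain ⟨C, hC0, hC⟩ := exists_unifProb_numInRunsUpTo_le hb hb1 hab
  -- Since b e^{1-b} ≤ 1. Consequently i + 1 ≤ a(n+1) implies i ≤ an, as the induction requires.
  have ha1 : a ≤ 1 := by
    have h1 := Real.add_one_le_exp (b - 1)
    have h2 : Real.exp (b - 1) * Real.exp (1 - b) = 1 := by
      rw [← Real.exp_add]
      simp
    nlinarith [Real.exp_pos (1 - b)]
  -- With bM = C + 3 the recursion turns M/(i+1) into (M-1)/(i+1), which is at most M/(i+2) once M ≤
  -- i + 2. For smaller i the trivial bound 1 suffices.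
  obtain ⟨M, hM⟩ : ∃ M : ℝ, M = (C + 3) / b := ⟨_, rfl⟩
  have hbM : b * M = C + 3 := by
    rw [hM]
    field_simp
  have hM3 : 3 ≤ M := by nlinarith
  refine ⟨M, by linarith, fun i => ?_⟩
  induction i with
  | zero =>
    intro n j _ _ hj
    refine (abs_cdfAt_sub_exp_le_one hj).trans ?_
    simp
    linarith
  | succ i ih =>
    intro n j hi hbj hj
    push_cast at hi ⊢
    rcases le_or_gt ((i : ℝ) + 1 + 1) M with hiM | hiM
    · refine (abs_cdfAt_sub_exp_le_one hj).trans ?_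
      rwa [le_div_iff₀ (by positivity), one_mul]
    · have hn1 : ((i + 1 : ℕ) : ℝ) ≤ n := by
        push_cast
        exact hi.trans (mul_le_of_le_one_left (by positivity) ha1)
      have hn1' : i + 1 ≤ n := by exact_mod_cast hn1
      obtain ⟨n, rfl⟩ : ∃ m, n = m + 1 := ⟨n - 1, by omega⟩
      have hi1 : (1 : ℝ) < i := by linarith
      have hi1' : 1 < i := by exact_mod_cast hi1
      push_cast at hi hbj hn1
      have hB := hC (n + 1) (i + 1) j (by omega) (by push_cast; exact hi) (by push_cast; exact hbj)
      have h := abs_cdfAt_succ_sub_exp_le (ε := M / (i + 1)) (by omega) (by omega) hj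
        (fun c hjc hcn => ih n c (by nlinarith)
          (by
            have : (j : ℝ) ≤ c := by exact_mod_cast hjc
            nlinarith) hcn) hB
      refine h.trans ?_
      have hn0 : (0 : ℝ) < n + 1 := by positivity
      have hi0 : (0 : ℝ) < (i : ℝ) + 1 := by positivity
      have e1 : 1 - (j : ℝ) / (n + 1) ≤ 1 - b := by
        have : b ≤ (j : ℝ) / (n + 1) := by rwa [le_div_iff₀ hn0]
        linarith
      have e2 : 2 / ((n : ℝ) + 1) ≤ 2 / (i + 1) := by gcongr
      have e3 : C / ((n + 1 : ℕ) : ℝ) ≤ C / (i + 1) := by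
        push_cast
        gcongr
      calc (1 - (j : ℝ) / (n + 1)) * (M / (i + 1) + 2 / (n + 1)) + C / ((n + 1 : ℕ) : ℝ)
          ≤ (1 - b) * (M / (i + 1) + 2 / (i + 1)) + C / (i + 1) := by
            gcongr
        _ ≤ (1 - b) * (M / (i + 1)) + 2 / (i + 1) + C / (i + 1) := by
            have : 0 ≤ b * (2 / ((i : ℝ) + 1)) := by positivity
            linarith
        _ = ((1 - b) * M + 2 + C) / (i + 1) := by ring
        _ ≤ M / (i + 1 + 1) := by
            rw [div_le_div_iff₀ hi0 (by positivity)]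
            have : (1 - b) * M = M - (C + 3) := by linarith
            rw [this]
            nlinarith

theorem exists_abs_mul_pInterior_sub_exp_le {x y : ℝ} (hx : 0 < x) (hy : 0 < y) (hy1 : y ≤ 1)
    (hxy : x < y * Real.exp (1 - y)) :
    ∃ C : ℝ, ∀ n : ℕ, 1 ≤ n →
      |n * pInterior n ⌈x * n⌉₊ ⌈y * n⌉₊ - Real.exp (y - 1)| ≤ C / n := by
  -- The slack b < y and x < a < b e^{1-b} absorbs the ceilings and the shift from n to n - 1; it
  -- also gives b < 1 when y = 1.
  obtain ⟨b, hb, hby, hxb⟩ : ∃ b, 0 < b ∧ b < y ∧ x < b * Real.exp (1 - b) := by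
    have hcont : Continuous fun t : ℝ => t * Real.exp (1 - t) := by fun_prop
    have h1 : ∀ᶠ t in 𝓝[<] y, x < t * Real.exp (1 - t) :=
      nhdsWithin_le_nhds (hcont.continuousAt.eventually (lt_mem_nhds hxy))
    have h2 : ∀ᶠ t in 𝓝[<] y, 0 < t := nhdsWithin_le_nhds (lt_mem_nhds hy)
    obtain ⟨t, h1, h2, h3⟩ := (h1.and (h2.and self_mem_nhdsWithin)).exists
    exact ⟨t, h2, h3, h1⟩
  obtain ⟨a, hxa, hab⟩ := exists_between hxb
  obtain ⟨M, hM0, hM⟩ := exists_abs_cdfAt_sub_exp_le hb (hby.trans_le hy1) hab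
  obtain ⟨N, hN⟩ := exists_nat_ge (max 1 (max (x / (a - x)) (1 / (y - b))))
  simp only [max_le_iff] at hN
  obtain ⟨hN1, hNa, hNb⟩ := hN
  refine ⟨max (M / x + 2) ((N + 1 + 1) * (N + 1)), fun n hn => ?_⟩
  have hn0 : (0 : ℝ) < n := by exact_mod_cast hn
  have hexp0 := Real.exp_pos (y - 1)
  have hexp1 : Real.exp (y - 1) ≤ 1 := Real.exp_le_one_iff.2 (by linarith)
  rcases lt_or_ge N (n - 1) with hlarge | hsmall
  · obtain ⟨m, rfl⟩ : ∃ m, n = m + 1 := ⟨n - 1, by omega⟩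
    have hi0 : 0 < ⌈x * (m + 1 : ℕ)⌉₊ := Nat.ceil_pos.2 (by positivity)
    have hj0 : 0 < ⌈y * (m + 1 : ℕ)⌉₊ := Nat.ceil_pos.2 (by positivity)
    have hile := Nat.le_ceil (x * (m + 1 : ℕ))
    have hilt := Nat.ceil_lt_add_one (show 0 ≤ x * (m + 1 : ℕ) by positivity)
    have hjle := Nat.le_ceil (y * (m + 1 : ℕ))
    have hjlt := Nat.ceil_lt_add_one (show 0 ≤ y * (m + 1 : ℕ) by positivity)
    have hjn : ⌈y * (m + 1 : ℕ)⌉₊ ≤ m + 1 :=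
      Nat.ceil_le.2 (mul_le_of_le_one_left (by positivity) hy1)
    obtain ⟨i, hi⟩ : ∃ i, ⌈x * (m + 1 : ℕ)⌉₊ = i + 1 := ⟨_, (Nat.sub_add_cancel hi0).symm⟩
    obtain ⟨j, hj⟩ : ∃ j, ⌈y * (m + 1 : ℕ)⌉₊ = j + 1 := ⟨_, (Nat.sub_add_cancel hj0).symm⟩
    rw [hi, hj, pInterior_succ m i j (by omega)]
    rw [hi] at hile hilt
    rw [hj] at hjle hjlt hjn
    push_cast at hile hilt hjle hjlt
    have hmN : (N : ℝ) ≤ m := by exact_mod_cast (by omega : N ≤ m)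
    have hm1 : (1 : ℝ) ≤ m := hN1.trans hmN
    have hm0 : (0 : ℝ) < m := by linarith
    have ha' : x ≤ (a - x) * m := by
      rw [← div_le_iff₀' (by linarith)]
      exact hNa.trans hmN
    have hb' : 1 ≤ (y - b) * m := by
      rw [← div_le_iff₀' (by linarith)]
      exact hNb.trans hmN
    have hjm : (j : ℝ) ≤ m := by exact_mod_cast (by omega : j ≤ m)
    have h1 := hM i m j (by linarith) (by linarith) (by omega)
    have h2 := abs_exp_sub_exp_le (u := (j : ℝ) / m - 1) (v := y - 1)
      (by rw [sub_nonpos, div_le_one hm0]; exact hjm) (by linarith)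
    have h3 : |(j : ℝ) / m - 1 - (y - 1)| ≤ 2 / (m + 1) := by
      have e : (j : ℝ) / m - 1 - (y - 1) = (j - y * m) / m := by
        field_simp
        ring
      rw [e, abs_div, abs_of_pos hm0, div_le_div_iff₀ hm0 (by positivity)]
      have : |(j : ℝ) - y * m| ≤ 1 := by
        rw [abs_le]
        constructor <;> linarith
      nlinarith
    -- Positivity of x enters here: the position i + 1 ≥ x(m+1) grows linearly, so an error O(1/i)
    -- is O(1/n).
    have h4 : M / ((i : ℝ) + 1) ≤ M / x / (m + 1) := by
      rw [div_div]
      gcongr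
    have e : ((m + 1 : ℕ) : ℝ) * (cdfAt m i j / (m + 1)) = cdfAt m i j := by
      push_cast
      field_simp
    rw [e]
    calc |cdfAt m i j - Real.exp (y - 1)| ≤ M / x / (m + 1) + 2 / (m + 1) :=
          (abs_sub_le _ (Real.exp (j / m - 1)) _).trans
            (add_le_add (h1.trans h4) (h2.trans h3))
      _ = (M / x + 2) / (m + 1 : ℕ) := by
          push_cast
          ring
      _ ≤ _ := by
          gcongr
          exact le_max_left _ _
  · have hp0 := unifProb_nonneg n fun π => EntryAt π ⌈x * n⌉₊ ⌈y * n⌉₊ ∧ ¬ BeginsRun π ⌈y * n⌉₊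
    have hp1 := unifProb_le_one n fun π => EntryAt π ⌈x * n⌉₊ ⌈y * n⌉₊ ∧ ¬ BeginsRun π ⌈y * n⌉₊
    change 0 ≤ pInterior n ⌈x * n⌉₊ ⌈y * n⌉₊ at hp0
    change pInterior n ⌈x * n⌉₊ ⌈y * n⌉₊ ≤ 1 at hp1
    have hnN : (n : ℝ) ≤ N + 1 := by exact_mod_cast (by omega : n ≤ N + 1)
    rw [le_div_iff₀ hn0]
    have h1 : |n * pInterior n ⌈x * n⌉₊ ⌈y * n⌉₊ - Real.exp (y - 1)| ≤ N + 1 + 1 := by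
      rw [abs_le]
      constructor <;> nlinarith
    calc _ ≤ ((N : ℝ) + 1 + 1) * (N + 1) := by gcongr
      _ ≤ _ := le_max_right _ _

theorem lemma4p3 (x y : ℝ) (hx : x ∈ Set.Ioc (0 : ℝ) 1) (hy : y ∈ Set.Ioc (0 : ℝ) 1)
    (hxy : (x, y) ∈ regionAbove) :
    (∃ C : ℝ, ∀ n : ℕ, 1 ≤ n →
      |pInterior n ⌈x * n⌉₊ ⌈y * n⌉₊ - Real.exp (y - 1) / n| ≤ C / (n : ℝ) ^ 2) ∧
    Filter.Tendsto (fun n : ℕ => (n : ℝ) * pInterior n ⌈x * n⌉₊ ⌈y * n⌉₊) Filter.atTop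
      (nhds (Real.exp (y - 1))) := by
  obtain ⟨C, hC⟩ := exists_abs_mul_pInterior_sub_exp_le hx.1 hy.1 hy.2 hxy.2.2
  constructor
  · refine ⟨C, fun n hn => ?_⟩
    have hn0 : (0 : ℝ) < n := by exact_mod_cast hn
    have e : pInterior n ⌈x * n⌉₊ ⌈y * n⌉₊ - Real.exp (y - 1) / n =
        (n * pInterior n ⌈x * n⌉₊ ⌈y * n⌉₊ - Real.exp (y - 1)) / n := by
      field_simp
    rw [e, abs_div, abs_of_pos hn0, sq, ← div_div]
    gcongr
    exact hC n hn
  · rw [tendsto_iff_norm_sub_tendsto_zero]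
    refine squeeze_zero' (Eventually.of_forall fun n => norm_nonneg _) ?_
      (tendsto_const_div_atTop_nhds_zero_nat C)
    filter_upwards [eventually_ge_atTop 1] with n hn
    exact hC n hn
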